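/- **Setting.** Let $l>1$ be an odd integer and let $k$ be a field of characteristic $0$ containing a primitive $l$-th root of unity $q$ (for instance $k=\mathbb Q(q)$). Let $U$ be the $\mathbb Z[v,v^{-1}]$-form with divided powers of the quantum group of $\mathfrak{sl}_2$ over $\mathbb Q(v)$, i.e. the subalgebra generated by $E^{(i)}=E^i/[i]!$, $F^{(i)}=F^i/[i]!$ $(i\ge 0)$ and $K^{\pm1}$, where $KE=v^2EK$, $KF=v^{-2}FK$, $EF-FE=\frac{K-K^{-1}}{v-v^{-1}}$ and $[i]!=\prod_{h=1}^{i}\frac{v^h-v^{-h}}{v-v^{-1}}$. Let $U_q=U\otimes_{\mathbb Z[v,v^{-1}]}k$ (with $v\mapsto q$), and let the small quantum group $\mathfrak u_q$ be the $k$-subalgebra of $U_q$ generated by $E,F,K$. All modules are left modules. Put $q^{1/2}=-q^{(1-l)/2}$ and, for $n\in\mathbb Z$, $$\kappa'_n=\frac1{2l}\sum_{i=0}^{2l-1}(q^{1/2})^{-ni}K^i\in\mathfrak u_q .$$ For $m\in\mathbb Z$ let $\bar\Delta_q(m)=\mathfrak u_q\otimes_{\mathfrak u_q^{\ge0}}m$,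 where $\mathfrak u_q^{\ge0}$ is the subalgebra generated by $E$ and $K$, and $m$ denotes the line on which $K$ acts by $q^m$ and $E$ by $0$. Let $\bar L_q(m)$ be the simple quotient of $\bar\Delta_q(m)$ (the simple module of highest weight $m$), let $Q_q(m)$ be the projective cover of $\bar L_q(m)$, and let $\mathrm{St}_q=\bar\Delta_q(l-1)$ be the Steinberg module. For a $\mathfrak u_q$-module $M$, let $\widetilde M$ be the module obtained by twisting the action by the automorphism $E\mapsto-E$, $F\mapsto F$, $K\mapsto-K$. **Proposition.** Let $n$ be an integer with $0\le n<2l$. All index sets below are sets of integers $r$. (i) If $n=2m$ is even, then $$\mathfrak u_q\kappa'_n\;\cong\;\bigoplus_{r\in\mathbb Z\cap([0,\frac m2[\,\cup\,[m,\frac{l+m-1}2])}Q_q(2r-m).$$ The index $r=\frac{l+m-1}2$ (if $m$ is even), resp. $r=\frac{m-1}2$ (if $m$ is odd), belongs to the index set, and $Q_q(2r-m)\cong\mathrm{St}_q$ for this $r$. (ii) If $n$ is odd, then $$\widetilde{\mathfrak u_q\kappa'_n}\;\cong\;\bigoplus_{r\in\mathbb Z\cap I_n}Q_q\Bigl(2r+\frac{(l-1)n}2\Bigr),\qquad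 I_n=\begin{cases} [0,\frac{l-1}4]\cup[\frac{l+1}2,\frac{3l+1}4[ & \text{if } n=1,\\[2pt] [0,\frac{l+n}4[\,\cup\,[\frac{l+n}2,\frac{3l+n}4[ & \text{if } 1<n<l,\\[2pt] [0,\frac{n-l}4[\,\cup\,[\frac{n-l}2,\frac{l+n}4[ & \text{if } n\ge l. \end{cases}$$ There is an $r$ in the index set with $4r\equiv n-2 \pmod l$, and $Q_q(2r+\frac{(l-1)n}2)\cong\mathrm{St}_q$ for every such $r$. -/

import Mathlib

open scoped TensorProduct DirectSum

noncomputable section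

namespace SmallQuantum

/-! ### The quantum group of `sl₂` over `ℚ(v)` and its form with divided powers -/

/-- `𝒜 = ℤ[v, v⁻¹]`. -/
abbrev A : Type := LaurentPolynomial ℤ

/-- `ℚ(v)`, the field of fractions of `𝒜`. -/
abbrev Qv : Type := FractionRing A

/-- The indeterminate `v`, as an element of `ℚ(v)`. -/
def v : Qv := algebraMap A Qv (LaurentPolynomial.T 1)

/-- Names of the generators `E, F, K, K⁻¹`. -/
inductive Gen : Type
  | E | F | K | Kinv

/-- The free algebra over `ℚ(v)` on `E, F, K, K⁻¹`. -/
abbrev Free : Type := FreeAlgebra Qv Gen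

/-- A generator, as an element of the free algebra. -/
abbrev gen (g : Gen) : Free := FreeAlgebra.ι Qv g

/-- The defining relations of the quantum group of `sl₂` over `ℚ(v)`. -/
inductive Rel : Free → Free → Prop
  | K_Kinv : Rel (gen .K * gen .Kinv) 1
  | Kinv_K : Rel (gen .Kinv * gen .K) 1
  | K_E : Rel (gen .K * gen .E) (v ^ 2 • (gen .E * gen .K))
  | K_F : Rel (gen .K * gen .F) ((v ^ 2)⁻¹ • (gen .F * gen .K))
  | E_F : Rel (gen .E * gen .F - gen .F * gen .E) ((v - v⁻¹)⁻¹ • (gen .K - gen .Kinv))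

/-- The quantum group of `sl₂` over `ℚ(v)`. -/
def UQv : Type := RingQuot Rel

instance : Ring UQv :=
  letI : Algebra Qv (RingQuot Rel) := inferInstance
  (Algebra.semiringToRing Qv : Ring (RingQuot Rel))

instance : Algebra Qv UQv := inferInstanceAs (Algebra Qv (RingQuot Rel))

instance : Algebra A UQv := inferInstanceAs (Algebra A (RingQuot Rel))

instance : IsScalarTower A Qv UQv := inferInstanceAs (IsScalarTower A Qv (RingQuot Rel))

/-- The quotient map from the free algebra. -/
def mk : Free →ₐ[Qv] UQv := RingQuot.mkAlgHom Qv Rel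

/-- A generator, as an element of the quantum group over `ℚ(v)`. -/
def ug (g : Gen) : UQv := mk (gen g)

/-- The quantum integer `[n] = (vⁿ - v⁻ⁿ) / (v - v⁻¹)`. -/
def qInt (n : ℕ) : Qv := (v ^ n - (v ^ n)⁻¹) / (v - v⁻¹)

/-- The quantum factorial `[n]! = [1][2]⋯[n]`. -/
def qFact (n : ℕ) : Qv := ∏ h ∈ Finset.range n, qInt (h + 1)

/-- The divided power `x⁽ⁿ⁾ = xⁿ / [n]!`. -/
def divPow (x : UQv) (n : ℕ) : UQv := (qFact n)⁻¹ • x ^ n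

/-- The set `{E⁽ⁿ⁾, F⁽ⁿ⁾ | n ∈ ℕ} ∪ {K, K⁻¹}`. -/
def generators : Set UQv :=
  Set.range (divPow (ug .E)) ∪ Set.range (divPow (ug .F)) ∪ {ug .K, ug .Kinv}

/-- The `𝒜`-form with divided powers: the `𝒜`-subalgebra generated by the
`E⁽ⁿ⁾`, `F⁽ⁿ⁾`, `K` and `K⁻¹`. -/
def U : Subalgebra A UQv := Algebra.adjoin A generators

theorem divPow_one (x : UQv) (hx : v - v⁻¹ ≠ 0) : divPow x 1 = x := by
  simp [divPow, qFact, qInt, div_self hx]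

theorem v_sub_inv_ne_zero : v - v⁻¹ ≠ 0 := by
  have hinj : Function.Injective (algebraMap A Qv) := IsFractionRing.injective A Qv
  have hv0 : v ≠ 0 := by
    intro h
    have h1 : (LaurentPolynomial.T 1 : A) = 0 := hinj (by rw [map_zero]; exact h)
    exact (LaurentPolynomial.isUnit_T (R := ℤ) 1).ne_zero h1
  intro h
  have h2 : v * v = 1 := by
    have h3 := sub_eq_zero.mp h
    calc v * v = v * v⁻¹ := by rw [← h3]
      _ = 1 := mul_inv_cancel₀ hv0
  have h4 : (LaurentPolynomial.T 1 : A) * LaurentPolynomial.T 1 = 1 :=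
    hinj (by rw [map_mul, map_one]; exact h2)
  have h5 := congrArg
    (LaurentPolynomial.eval₂ (Int.castRingHom ℚ) (Units.mk0 (2 : ℚ) two_ne_zero)) h4
  rw [map_mul, map_one, LaurentPolynomial.eval₂_T] at h5
  norm_num at h5

theorem ug_mem_U (g : Gen) : ug g ∈ U := by
  apply Algebra.subset_adjoin
  cases g with
  | E => exact Or.inl (Or.inl ⟨1, divPow_one _ v_sub_inv_ne_zero⟩)
  | F => exact Or.inl (Or.inr ⟨1, divPow_one _ v_sub_inv_ne_zero⟩)
  | K => exact Or.inr (Or.inl rfl)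
  | Kinv => exact Or.inr (Or.inr rfl)

/-! ### The twist `E ↦ -E`, `F ↦ F`, `K ↦ -K` over `ℚ(v)` and over `𝒜` -/

/-- The images of the generators under the twist. -/
def tildeGen : Gen → UQv
  | .E => -ug .E
  | .F => ug .F
  | .K => -ug .K
  | .Kinv => -ug .Kinv

theorem tildeGen_rel ⦃x y : Free⦄ (h : Rel x y) :
    FreeAlgebra.lift Qv tildeGen x = FreeAlgebra.lift Qv tildeGen y := by
  have hk : mk x = mk y := RingQuot.mkAlgHom_rel Qv h
  cases h with
  | K_Kinv =>
    simp only [map_mul, map_one, FreeAlgebra.lift_ι_apply, tildeGen] at hk ⊢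
    rw [neg_mul_neg]
    exact hk
  | Kinv_K =>
    simp only [map_mul, map_one, FreeAlgebra.lift_ι_apply, tildeGen] at hk ⊢
    rw [neg_mul_neg]
    exact hk
  | K_E =>
    simp only [map_mul, map_smul, FreeAlgebra.lift_ι_apply, tildeGen] at hk ⊢
    rw [neg_mul_neg, neg_mul_neg]
    exact hk
  | K_F =>
    simp only [map_mul, map_smul, FreeAlgebra.lift_ι_apply, tildeGen] at hk ⊢
    rw [neg_mul, mul_neg, smul_neg]
    exact congrArg Neg.neg hk
  | E_F =>
    have hk' : ug .E * ug .F - ug .F * ug .E = (v - v⁻¹)⁻¹ • (ug .K - ug .Kinv) := by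
      rw [map_sub, map_smul, map_sub, map_mul, map_mul] at hk
      exact hk
    have h1 : ∀ a b : UQv, -a * b - b * -a = -(a * b - b * a) := fun a b => by noncomm_ring
    have h2 : ∀ a b : UQv, -a - -b = -(a - b) := fun a b => by abel
    rw [map_sub, map_smul, map_sub, map_mul, map_mul]
    simp only [FreeAlgebra.lift_ι_apply, tildeGen]
    rw [h1, h2, smul_neg, hk']

/-- The algebra endomorphism `E ↦ -E`, `F ↦ F`, `K ↦ -K` of the quantum group over `ℚ(v)`
(it is its own inverse). -/
def tildeQv : UQv →ₐ[Qv] UQv :=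
  (RingQuot.liftAlgHom Qv (s := Rel) (B := UQv)) ⟨FreeAlgebra.lift Qv tildeGen, tildeGen_rel⟩

theorem tildeQv_ug (g : Gen) : tildeQv (ug g) = tildeGen g := by
  have h : RingQuot.liftAlgHom Qv (s := Rel) (B := UQv)
      ⟨FreeAlgebra.lift Qv tildeGen, tildeGen_rel⟩ (RingQuot.mkAlgHom Qv Rel (gen g)) =
      FreeAlgebra.lift Qv tildeGen (gen g) := RingQuot.liftAlgHom_mkAlgHom_apply ..
  rw [FreeAlgebra.lift_ι_apply] at h
  exact h

theorem tildeQv_mem_U {x : UQv} (hx : x ∈ U) : tildeQv x ∈ U := by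
  have h : U ≤ U.comap (tildeQv.restrictScalars A) := by
    refine Algebra.adjoin_le ?_
    rintro y ((⟨n, rfl⟩ | ⟨n, rfl⟩) | rfl | rfl)
    · have h1 : tildeQv (divPow (ug .E) n) = (-1) ^ n * divPow (ug .E) n := by
        simp only [divPow, map_smul, map_pow, tildeQv_ug, tildeGen]
        rw [neg_pow, mul_smul_comm]
      change tildeQv (divPow (ug .E) n) ∈ U
      rw [h1]
      exact U.mul_mem (U.pow_mem (U.neg_mem U.one_mem) n)
        (Algebra.subset_adjoin (Or.inl (Or.inl ⟨n, rfl⟩)))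
    · have h1 : tildeQv (divPow (ug .F) n) = divPow (ug .F) n := by
        simp only [divPow, map_smul, map_pow, tildeQv_ug, tildeGen]
      change tildeQv (divPow (ug .F) n) ∈ U
      rw [h1]
      exact Algebra.subset_adjoin (Or.inl (Or.inr ⟨n, rfl⟩))
    · change tildeQv (ug .K) ∈ U
      rw [tildeQv_ug]
      exact U.neg_mem (ug_mem_U .K)
    · change tildeQv (ug .Kinv) ∈ U
      rw [tildeQv_ug]
      exact U.neg_mem (ug_mem_U .Kinv)
  exact h hx

/-- The twist on the `𝒜`-form. -/
def tildeU : U →ₐ[A] U :=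
  ((tildeQv.restrictScalars A).comp U.val).codRestrict U fun x => tildeQv_mem_U x.2

/-! ### Specialization and the small quantum group -/

section Specialized

/- `k` is a field over `𝒜`; the image of `v` in `k` is the parameter `q`. -/
variable (k : Type*) [Field k] [Algebra A k]

/-- The parameter `q`: the image of `v` in `k`. -/
def q : k := algebraMap A k (LaurentPolynomial.T 1)

/-- The specialization `U_q = k ⊗ U` at `v = q` of the form with divided powers. -/
def Uq : Type _ := k ⊗[A] U

instance : Ring (Uq k) := inferInstanceAs (Ring (k ⊗[A] U))

instance : Algebra k (Uq k) := inferInstanceAs (Algebra k (k ⊗[A] U))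

/-- A generator, as an element of `U_q`. -/
def uqGen (g : Gen) : Uq k := (1 : k) ⊗ₜ[A] (⟨ug g, ug_mem_U g⟩ : U)

/-- The small quantum group: the `k`-subalgebra of `U_q` generated by `E`, `F`, `K`. -/
def u : Subalgebra k (Uq k) := Algebra.adjoin k {uqGen k .E, uqGen k .F, uqGen k .K}

/-- `E` as an element of the small quantum group. -/
def E : u k := ⟨uqGen k .E, Algebra.subset_adjoin (Or.inl rfl)⟩

/-- `F` as an element of the small quantum group. -/
def F : u k := ⟨uqGen k .F, Algebra.subset_adjoin (Or.inr (Or.inl rfl))⟩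

/-- `K` as an element of the small quantum group. -/
def K : u k := ⟨uqGen k .K, Algebra.subset_adjoin (Or.inr (Or.inr rfl))⟩

/-- The twist on `U_q`. -/
def tildeUq : Uq k →ₐ[k] Uq k :=
  (Algebra.TensorProduct.map (AlgHom.id k k) tildeU : k ⊗[A] U →ₐ[k] k ⊗[A] U)

theorem tildeUq_uqGen_E : tildeUq k (uqGen k .E) = -uqGen k .E := by
  have h : tildeU ⟨ug .E, ug_mem_U .E⟩ = -⟨ug .E, ug_mem_U .E⟩ := Subtype.ext (tildeQv_ug .E)
  have h' := Algebra.TensorProduct.map_tmul (AlgHom.id k k) tildeU (1 : k)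
    (⟨ug .E, ug_mem_U .E⟩ : U)
  rw [h, TensorProduct.tmul_neg] at h'
  exact h'

theorem tildeUq_uqGen_F : tildeUq k (uqGen k .F) = uqGen k .F := by
  have h : tildeU ⟨ug .F, ug_mem_U .F⟩ = ⟨ug .F, ug_mem_U .F⟩ := Subtype.ext (tildeQv_ug .F)
  have h' := Algebra.TensorProduct.map_tmul (AlgHom.id k k) tildeU (1 : k)
    (⟨ug .F, ug_mem_U .F⟩ : U)
  rw [h] at h'
  exact h'

theorem tildeUq_uqGen_K : tildeUq k (uqGen k .K) = -uqGen k .K := by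
  have h : tildeU ⟨ug .K, ug_mem_U .K⟩ = -⟨ug .K, ug_mem_U .K⟩ := Subtype.ext (tildeQv_ug .K)
  have h' := Algebra.TensorProduct.map_tmul (AlgHom.id k k) tildeU (1 : k)
    (⟨ug .K, ug_mem_U .K⟩ : U)
  rw [h, TensorProduct.tmul_neg] at h'
  exact h'

theorem tildeUq_mem_u {x : Uq k} (hx : x ∈ u k) : tildeUq k x ∈ u k := by
  have h : u k ≤ (u k).comap (tildeUq k) := by
    refine Algebra.adjoin_le ?_
    rintro y (rfl | rfl | rfl)
    · change tildeUq k _ ∈ u k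
      rw [tildeUq_uqGen_E]
      exact (u k).neg_mem (E k).2
    · change tildeUq k _ ∈ u k
      rw [tildeUq_uqGen_F]
      exact (F k).2
    · change tildeUq k _ ∈ u k
      rw [tildeUq_uqGen_K]
      exact (u k).neg_mem (K k).2
  exact h hx

/-- The twist `E ↦ -E`, `F ↦ F`, `K ↦ -K` on the small quantum group. -/
def tilde : u k →ₐ[k] u k :=
  ((tildeUq k).comp (u k).val).codRestrict (u k) fun x => tildeUq_mem_u k x.2

/-- The twisted module `M~`: the additive group `M`, on which `x` acts as `tilde x` acts on `M`. -/
def Twist (M : Type*) : Type _ := M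

instance (M : Type*) [AddCommGroup M] : AddCommGroup (Twist M) := inferInstanceAs (AddCommGroup M)

instance (M : Type*) [AddCommGroup M] [Module (u k) M] : Module (u k) (Twist M) :=
  Module.compHom M (tilde k).toRingHom

/-! ### The idempotents and the modules -/

/-- The square root `q^{1/2} = -q^{(1-l)/2}` of `q` (for `l` odd and `q ^ l = 1`). -/
def sqrtq (l : ℕ) : k := -q k ^ ((1 - (l : ℤ)) / 2)

/-- `κ'ₙ = (1 / 2l) ∑_{0 ≤ i < 2l} q^{-ni/2} Kⁱ`. -/
def kappa' (l : ℕ) (n : ℤ) : u k :=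
  ((2 * l : k)⁻¹) • ∑ i ∈ Finset.range (2 * l), (sqrtq k l ^ (-(n * (i : ℤ)))) • K k ^ i

/-- The left `u_q`-module `u_q κ'ₙ` (a left ideal of `u_q`). -/
abbrev uKappa' (l : ℕ) (n : ℤ) : Submodule (u k) (u k) := Submodule.span (u k) {kappa' k l n}

/-- `Δ̄_q(m) = u_q ⊗_{u_q^{≥0}} m`, where `u_q^{≥0}` is generated by `E` and `K`, which act
on the line `m` by `0` and `q ^ m`.  As `m` is the quotient of `u_q^{≥0}` by the left ideal
generated by `E` and `K - q ^ m`, this is the quotient of `u_q` by the left ideal which these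
two elements generate. -/
abbrev Delta (m : ℤ) : Type _ :=
  u k ⧸ Submodule.span (u k) {E k, K k - algebraMap k (u k) (q k ^ m)}

/-- The simple module `L̄_q(m)` of highest weight `m`: the quotient of `Δ̄_q(m)` by the sum of
its proper submodules. -/
abbrev L (m : ℤ) : Type _ := Delta k m ⧸ sSup {N : Submodule (u k) (Delta k m) | N ≠ ⊤}

/-- The Steinberg module `St_q = Δ̄_q(l - 1)`. -/
abbrev St (l : ℕ) : Type _ := Delta k ((l : ℤ) - 1)

end Specialized

/-- `P` is a projective cover of `M`: `P` is projective and there is a surjection `π : P → M`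
whose kernel is superfluous. -/
def IsProjectiveCover (R P M : Type*) [Ring R] [AddCommGroup P] [Module R P]
    [AddCommGroup M] [Module R M] : Prop :=
  Module.Projective R P ∧ ∃ π : P →ₗ[R] M, Function.Surjective π ∧
    ∀ N : Submodule R P, N ⊔ LinearMap.ker π = ⊤ → N = ⊤

/-- `M` is the direct sum, over `r ∈ I`, of submodules `N r` which are projective covers of the
simple modules `L̄_q(wt r)`; and for the `r ∈ I` such that `isSt r`, of which there is at least
one, `N r` is isomorphic to the Steinberg module. -/
def DecomposesAs (k : Type*) [Field k] [Algebra A k] (l : ℕ) (M : Type*) [AddCommGroup M]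
    [Module (u k) M] (I : Set ℤ) (wt : ℤ → ℤ) (isSt : ℤ → Prop) : Prop :=
  ∃ N : I → Submodule (u k) M, DirectSum.IsInternal N ∧
    (∀ r : I, IsProjectiveCover (u k) (N r) (L k (wt r))) ∧
    (∃ r : I, isSt r) ∧ ∀ r : I, isSt r → Nonempty (N r ≃ₗ[u k] St k l)

end SmallQuantum

end

/-!
The proof uses only the Casimir element and weights; no PBW basis of `𝔲_q` is needed.

**Relations.** In `U_q` one has `Eˡ = [l]! E⁽ˡ⁾ = 0` and `Fˡ = 0`. That `K²ˡ = 1` follows from the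
straightening formula for `Eˡ F⁽ˡ⁾`: at `v = q` its left side and all terms on the right but the
last vanish, the latter being `[K; 0] [K; -1] ⋯ [K; 1 - l]`, a unit multiple of `Kˡ - K⁻ˡ`
(`pow_two_mul_eq_one`). Hence `κ'_{2m}` is an idempotent on whose left ideal `P = 𝔲_q κ'_{2m}` maps
are given by vectors of weight `m`.

**Blocks.** Let `C` be the Casimir element, which acts by `z(μ) = q^{μ+1} + q^{-μ-1}` on a highest
weight vector of weight `μ`; so `z(μ) = z(ν)` if and only if `μ ≡ ν` or `μ + ν ≡ -2` modulo `l`.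
From `FˡEˡ = 0` one gets `∏_{0 ≤ i < l} (C - z(m + 2i)) = 0` on `P`. Hence `P` is the direct sum of
its generalized eigenspaces for `C`, and the eigenvalues are the `z(2r - m)` for the `r` of the
proposition, each of them once. These eigenspaces are the summands `N r`
(`exists_decomposition`).

**Each summand is a projective cover.** The weight `m` part of `P` is `k[C] κ'_{2m}`, because `P` is
spanned by the `FⁱEʲκ'_{2m}` with `i, j < l`. Hence the weight `m` part of `N r` is a local ring
modulo which properness of submodules is detected, so `N r` is a local module
(`eq_top_or_eq_top`). It remains to find a surjection from `N r` to `L̄_q(2r - m)`. With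
`a ≡ 2r - m` and `0 ≤ a < l`, the index set is such that `a - 2j ≡ m` for some `0 ≤ j ≤ a`; then
`Fʲ` of the highest weight vector of `Δ̄_q(a)` has weight `m` and generates `Δ̄_q(a)`, as `EʲFʲ`
acts on the highest weight vector by a nonzero scalar. The resulting map `P → Δ̄_q(a)` is onto and
kills all `N s` with `s ≠ r`. Here `Δ̄_q(a) ≠ 0`, since `𝔲_q` acts on the specialization of the
simple `U`-module of dimension `a + 1` (`exists_rep`).

**Steinberg summand.** If `2r - m ≡ -1`, the eigenvalue is simple, and `N r` is a quotient of
`Δ̄_q(l - 1)` (`exists_delta_hom_surjective`). As there are surjections in both directions between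
these Noetherian modules, they are isomorphic.

**Odd `n`.** As `(q^{1/2})ˡ = -1`, the twist of `𝔲_q κ'ₙ` is `𝔲_q κ'_{n ± l}` (`exists_twist_equiv`),
and `n ± l` is even. The index set of the proposition is that of `m = (n ± l)/2`, and its weights
are the `2r - m` modulo `l`.
-/

noncomputable section

namespace SmallQuantum

/-! ### Relations in the quantum group over `ℚ(v)` -/

theorem ug_K_mul_Kinv : ug .K * ug .Kinv = 1 := by
  have h : mk (gen .K * gen .Kinv) = mk 1 := RingQuot.mkAlgHom_rel Qv Rel.K_Kinv
  rwa [map_mul, map_one] at h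

theorem ug_Kinv_mul_K : ug .Kinv * ug .K = 1 := by
  have h : mk (gen .Kinv * gen .K) = mk 1 := RingQuot.mkAlgHom_rel Qv Rel.Kinv_K
  rwa [map_mul, map_one] at h

theorem ug_K_mul_E : ug .K * ug .E = v ^ 2 • (ug .E * ug .K) := by
  have h : mk (gen .K * gen .E) = mk _ := RingQuot.mkAlgHom_rel Qv Rel.K_E
  rwa [map_smul, map_mul, map_mul] at h

theorem ug_K_mul_F : ug .K * ug .F = (v ^ 2)⁻¹ • (ug .F * ug .K) := by
  have h : mk (gen .K * gen .F) = mk _ := RingQuot.mkAlgHom_rel Qv Rel.K_F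
  rwa [map_smul, map_mul, map_mul] at h

theorem ug_E_mul_F_sub :
    ug .E * ug .F - ug .F * ug .E = (v - v⁻¹)⁻¹ • (ug .K - ug .Kinv) := by
  have h : mk (gen .E * gen .F - gen .F * gen .E) = mk _ := RingQuot.mkAlgHom_rel Qv Rel.E_F
  rwa [map_smul, map_sub, map_sub, map_mul, map_mul] at h

theorem algebraMap_T_ne_zero (n : ℤ) : algebraMap A Qv (LaurentPolynomial.T n) ≠ 0 := by
  intro h
  exact (LaurentPolynomial.isUnit_T (R := ℤ) n).ne_zero
    (IsFractionRing.injective A Qv (by rw [map_zero]; exact h))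

theorem v_ne_zero : v ≠ 0 := algebraMap_T_ne_zero 1

theorem algebraMap_T_eq_zpow {B : Type*} [DivisionRing B] [Algebra A B] (n : ℤ) :
    algebraMap A B (LaurentPolynomial.T n) = algebraMap A B (LaurentPolynomial.T 1) ^ n := by
  have h0 : ∀ m : ℕ, algebraMap A B (LaurentPolynomial.T m) =
      algebraMap A B (LaurentPolynomial.T 1) ^ m := fun m => by
    rw [← map_pow, LaurentPolynomial.T_pow, mul_one]
  obtain ⟨m, rfl | rfl⟩ := n.eq_nat_or_neg
  · rw [h0, zpow_natCast]
  · rw [zpow_neg, zpow_natCast, ← h0]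
    refine eq_inv_of_mul_eq_one_left ?_
    rw [← map_mul, ← LaurentPolynomial.T_add, neg_add_cancel, LaurentPolynomial.T_zero, map_one]

theorem v_pow_ne_inv (n : ℕ) : v ^ (n + 1) - (v ^ (n + 1))⁻¹ ≠ 0 := by
  intro h
  have h2 : v ^ (n + 1) * v ^ (n + 1) = 1 := by
    have h3 := sub_eq_zero.mp h
    nth_rw 1 [h3]
    exact inv_mul_cancel₀ (pow_ne_zero _ v_ne_zero)
  have h4 : (LaurentPolynomial.T 1 : A) ^ (n + 1) * LaurentPolynomial.T 1 ^ (n + 1) = 1 :=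
    IsFractionRing.injective A Qv (by rw [map_mul, map_one, map_pow]; exact h2)
  have h5 := congrArg
    (LaurentPolynomial.eval₂ (Int.castRingHom ℚ) (Units.mk0 (2 : ℚ) two_ne_zero)) h4
  rw [map_mul, map_one, map_pow, LaurentPolynomial.eval₂_T] at h5
  have h6 : (1 : ℚ) < 2 ^ (n + 1) := one_lt_pow₀ (by norm_num) (by omega)
  simp only [zpow_one, Units.val_mk0] at h5
  nlinarith

theorem qInt_succ_ne_zero (n : ℕ) : qInt (n + 1) ≠ 0 :=
  div_ne_zero (v_pow_ne_inv n) v_sub_inv_ne_zero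

theorem qFact_succ (n : ℕ) : qFact (n + 1) = qFact n * qInt (n + 1) :=
  Finset.prod_range_succ _ _

theorem qFact_ne_zero (n : ℕ) : qFact n ≠ 0 :=
  Finset.prod_ne_zero_iff.mpr fun i _ => qInt_succ_ne_zero i

theorem qFact_smul_divPow (x : UQv) (n : ℕ) : qFact n • divPow x n = x ^ n := by
  rw [divPow, smul_smul, mul_inv_cancel₀ (qFact_ne_zero n), one_smul]

theorem divPow_zero (x : UQv) : divPow x 0 = 1 := by simp [divPow, qFact]

theorem ug_Kinv_mul_F : ug .Kinv * ug .F = v ^ 2 • (ug .F * ug .Kinv) := by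
  have hv := v_ne_zero
  calc ug .Kinv * ug .F = ug .Kinv * (ug .F * (ug .K * ug .Kinv)) := by
        rw [ug_K_mul_Kinv, mul_one]
    _ = v ^ 2 • (ug .Kinv * ((v ^ 2)⁻¹ • (ug .F * ug .K)) * ug .Kinv) := by
        rw [mul_smul_comm, smul_mul_assoc, smul_smul, mul_inv_cancel₀ (pow_ne_zero 2 hv),
          one_smul]
        simp only [mul_assoc]
    _ = v ^ 2 • (ug .F * ug .Kinv) := by
        rw [← ug_K_mul_F, ← mul_assoc, ug_Kinv_mul_K, one_mul]

theorem ug_K_mul_F_pow (n : ℕ) :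
    ug .K * ug .F ^ n = (v ^ (2 * n))⁻¹ • (ug .F ^ n * ug .K) := by
  induction n with
  | zero => simp
  | succ n ih =>
    rw [pow_succ, ← mul_assoc, ih, smul_mul_assoc, mul_assoc, ug_K_mul_F, mul_smul_comm,
      smul_smul, ← mul_assoc]
    congr 1
    rw [← mul_inv, ← pow_add]
    ring_nf

theorem ug_E_mul_F_pow_sub (n : ℕ) :
    (v - v⁻¹) • (ug .E * ug .F ^ (n + 1) - ug .F ^ (n + 1) * ug .E) =
      qInt (n + 1) • (ug .F ^ n * ((v ^ n)⁻¹ • ug .K - v ^ n • ug .Kinv)) := by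
  have hv := v_ne_zero
  have hh := v_sub_inv_ne_zero
  have h1 : (v - v⁻¹) • (ug .E * ug .F - ug .F * ug .E) = ug .K - ug .Kinv := by
    rw [ug_E_mul_F_sub, smul_smul, mul_inv_cancel₀ hh, one_smul]
  induction n with
  | zero => simpa [qInt, div_self hh] using h1
  | succ n ih =>
    have e1 : ug .E * ug .F ^ (n + 1 + 1) - ug .F ^ (n + 1 + 1) * ug .E =
        (ug .E * ug .F ^ (n + 1) - ug .F ^ (n + 1) * ug .E) * ug .F +
          ug .F ^ (n + 1) * (ug .E * ug .F - ug .F * ug .E) := by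
      rw [pow_succ _ (n + 1)]; noncomm_ring
    have e2 : ug .F ^ n * ((v ^ n)⁻¹ • ug .K - v ^ n • ug .Kinv) * ug .F =
        ug .F ^ (n + 1) * ((v ^ (n + 2))⁻¹ • ug .K - v ^ (n + 2) • ug .Kinv) := by
      rw [mul_assoc, sub_mul, smul_mul_assoc, smul_mul_assoc, ug_K_mul_F, ug_Kinv_mul_F,
        pow_succ (ug .F), mul_assoc, mul_sub (ug .F), mul_smul_comm, mul_smul_comm, smul_smul, smul_smul,
        pow_add, mul_inv]
    rw [e1, smul_add, ← smul_mul_assoc, ih, smul_mul_assoc, e2,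
      ← mul_smul_comm (v - v⁻¹), h1, ← mul_smul_comm, ← mul_smul_comm, ← mul_add]
    congr 1
    rw [smul_sub, smul_sub, smul_smul, smul_smul, smul_smul, smul_smul]
    have c1 : qInt (n + 1) * (v ^ (n + 2))⁻¹ + 1 = qInt (n + 1 + 1) * (v ^ (n + 1))⁻¹ := by
      unfold qInt
      have : v ^ 2 - 1 ≠ 0 := by
        intro h; apply hh; field_simp; rw [h, mul_zero]
      field_simp
      ring
    have c2 : qInt (n + 1) * v ^ (n + 2) + 1 = qInt (n + 1 + 1) * v ^ (n + 1) := by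
      unfold qInt
      have : v ^ 2 - 1 ≠ 0 := by
        intro h; apply hh; field_simp; rw [h, mul_zero]
      field_simp
      ring
    rw [← c1, ← c2, add_smul, add_smul, one_smul, one_smul]
    abel

theorem ug_E_mul_divPow_F_sub (n : ℕ) :
    (v - v⁻¹) • (ug .E * divPow (ug .F) (n + 1) - divPow (ug .F) (n + 1) * ug .E) =
      divPow (ug .F) n * ((v ^ n)⁻¹ • ug .K - v ^ n • ug .Kinv) := by
  unfold divPow
  rw [mul_smul_comm, smul_mul_assoc, ← smul_sub, smul_comm, ug_E_mul_F_pow_sub, smul_smul,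
    qFact_succ, mul_inv, mul_assoc, inv_mul_cancel₀ (qInt_succ_ne_zero n), mul_one,
    smul_mul_assoc]

theorem ug_K_mul_divPow_F (n : ℕ) :
    ug .K * divPow (ug .F) n = (v ^ (2 * n))⁻¹ • (divPow (ug .F) n * ug .K) := by
  unfold divPow
  rw [mul_smul_comm, ug_K_mul_F_pow, smul_mul_assoc, smul_comm]

/-! ### Relations in `U_q` -/

/-- The quantum integer `[n]` as an element of `ℤ[v, v⁻¹]`, namely `∑ vⁿ⁻¹⁻²ⁱ`. -/
def qIntA (n : ℕ) : A := ∑ i ∈ Finset.range n, LaurentPolynomial.T ((n : ℤ) - 1 - 2 * i)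

/-- Both quantum integers in `ℚ(v)` and those in the field `k` are images of `qIntA`. -/
theorem mul_algebraMap_qIntA {B : Type*} [Field B] [Algebra A B] (n : ℕ) :
    (algebraMap A B (LaurentPolynomial.T 1) - (algebraMap A B (LaurentPolynomial.T 1))⁻¹) *
      algebraMap A B (qIntA n) = algebraMap A B (LaurentPolynomial.T 1) ^ n -
        (algebraMap A B (LaurentPolynomial.T 1) ^ n)⁻¹ := by
  set w := algebraMap A B (LaurentPolynomial.T 1)
  have hw : w ≠ 0 := ((LaurentPolynomial.isUnit_T (R := ℤ) 1).map (algebraMap A B)).ne_zero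
  rw [qIntA, map_sum, Finset.mul_sum]
  have h : ∀ i ∈ Finset.range n, (w - w⁻¹) * algebraMap A B
      (LaurentPolynomial.T ((n : ℤ) - 1 - 2 * i)) =
      w ^ ((n : ℤ) - 2 * i) - w ^ ((n : ℤ) - 2 * (i + 1 : ℕ)) := by
    intro i _
    rw [algebraMap_T_eq_zpow, sub_mul, ← zpow_one_add₀ hw, ← zpow_neg_one, ← zpow_add₀ hw]
    congr 2
    · ring
    · push_cast; ring
  rw [Finset.sum_congr rfl h, Finset.sum_range_sub' (fun i : ℕ => w ^ ((n : ℤ) - 2 * i))]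
  rw [← zpow_natCast, ← zpow_neg]
  congr 2
  all_goals ring

theorem algebraMap_qIntA (n : ℕ) : algebraMap A Qv (qIntA n) = qInt n :=
  (eq_div_iff v_sub_inv_ne_zero).mpr (by rw [mul_comm]; exact mul_algebraMap_qIntA (B := Qv) n)

/-- The quantum factorial `[n]!` as an element of `ℤ[v, v⁻¹]`. -/
def qFactA (n : ℕ) : A := ∏ i ∈ Finset.range n, qIntA (i + 1)

theorem algebraMap_qFactA (n : ℕ) : algebraMap A Qv (qFactA n) = qFact n := by
  simp only [qFactA, map_prod, algebraMap_qIntA]; rfl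

/-- The divided power `E⁽ⁿ⁾` in the `𝒜`-form. -/
def dividedE (n : ℕ) : U :=
  ⟨divPow (ug .E) n, Algebra.subset_adjoin (Or.inl (Or.inl ⟨n, rfl⟩))⟩

/-- The divided power `F⁽ⁿ⁾` in the `𝒜`-form. -/
def dividedF (n : ℕ) : U :=
  ⟨divPow (ug .F) n, Algebra.subset_adjoin (Or.inl (Or.inr ⟨n, rfl⟩))⟩

/-- A generator, as an element of the `𝒜`-form. -/
def genU (g : Gen) : U := ⟨ug g, ug_mem_U g⟩

section Specialized

variable (k : Type*) [Field k] [Algebra A k]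

/-- The specialization map `U → U_q`. -/
def toUq : U →+* Uq k := (Algebra.TensorProduct.includeRight : U →ₐ[A] k ⊗[A] U).toRingHom

theorem toUq_genU (g : Gen) : toUq k (genU g) = uqGen k g := rfl

theorem toUq_smul (a : A) (x : U) : toUq k (a • x) = algebraMap A k a • toUq k x := by
  change (1 : k) ⊗ₜ[A] (a • x) = algebraMap A k a • ((1 : k) ⊗ₜ[A] x)
  rw [TensorProduct.smul_tmul', ← TensorProduct.smul_tmul, smul_eq_mul, mul_one, Algebra.smul_def,
    mul_one]

theorem q_ne_zero : q k ≠ 0 :=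
  ((LaurentPolynomial.isUnit_T (R := ℤ) 1).map (algebraMap A k)).ne_zero

theorem algebraMap_T (n : ℤ) : algebraMap A k (LaurentPolynomial.T n) = q k ^ n :=
  algebraMap_T_eq_zpow n

theorem algebraMap_smul_UQv (a : A) (x : UQv) : a • x = algebraMap A Qv a • x :=
  (IsScalarTower.algebraMap_smul Qv a x).symm

theorem coe_T_smul (n : ℤ) (x : U) :
    (((LaurentPolynomial.T n : A) • x : U) : UQv) = v ^ n • (x : UQv) := by
  rw [Subalgebra.coe_smul, algebraMap_smul_UQv, algebraMap_T_eq_zpow]; rfl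

theorem uqGen_K_mul_Kinv : uqGen k .K * uqGen k .Kinv = 1 := by
  have h : genU .K * genU .Kinv = 1 := Subtype.ext ug_K_mul_Kinv
  rw [← toUq_genU, ← toUq_genU, ← map_mul, h, map_one]

theorem uqGen_Kinv_mul_K : uqGen k .Kinv * uqGen k .K = 1 := by
  have h : genU .Kinv * genU .K = 1 := Subtype.ext ug_Kinv_mul_K
  rw [← toUq_genU, ← toUq_genU, ← map_mul, h, map_one]

theorem uqGen_K_mul_E : uqGen k .K * uqGen k .E = q k ^ (2 : ℤ) • (uqGen k .E * uqGen k .K) := by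
  have h : genU .K * genU .E = (LaurentPolynomial.T 2 : A) • (genU .E * genU .K) := by
    apply Subtype.ext
    rw [coe_T_smul]
    exact ug_K_mul_E
  rw [← toUq_genU, ← toUq_genU, ← map_mul, h, toUq_smul, algebraMap_T, map_mul]

theorem uqGen_K_mul_dividedF (n : ℕ) : uqGen k .K * toUq k (dividedF n) =
    q k ^ (-(2 * n : ℤ)) • (toUq k (dividedF n) * uqGen k .K) := by
  have h : genU .K * dividedF n =
      (LaurentPolynomial.T (-(2 * n : ℤ)) : A) • (dividedF n * genU .K) := by
    apply Subtype.ext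
    rw [coe_T_smul, zpow_neg]
    exact_mod_cast ug_K_mul_divPow_F n
  rw [← toUq_genU, ← map_mul, h, toUq_smul, algebraMap_T, map_mul]

theorem dividedF_one : dividedF 1 = genU .F := Subtype.ext (divPow_one _ v_sub_inv_ne_zero)

theorem dividedF_zero : dividedF 0 = 1 := Subtype.ext (divPow_zero _)

theorem uqGen_E_mul_dividedF_sub (n : ℕ) :
    (q k - (q k)⁻¹) • (uqGen k .E * toUq k (dividedF (n + 1)) -
        toUq k (dividedF (n + 1)) * uqGen k .E) =
      toUq k (dividedF n) * (q k ^ (-n : ℤ) • uqGen k .K - q k ^ (n : ℤ) • uqGen k .Kinv) := by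
  have h : (LaurentPolynomial.T 1 - LaurentPolynomial.T (-1) : A) •
      (genU .E * dividedF (n + 1) - dividedF (n + 1) * genU .E) =
      dividedF n * ((LaurentPolynomial.T (-n : ℤ) : A) • genU .K -
        (LaurentPolynomial.T (n : ℤ) : A) • genU .Kinv) := by
    apply Subtype.ext
    rw [sub_smul, Subalgebra.coe_sub, coe_T_smul, coe_T_smul]
    have hsub : ∀ y : UQv, v ^ (1 : ℤ) • y - v ^ (-1 : ℤ) • y = (v ^ (1 : ℤ) - v ^ (-1 : ℤ)) • y :=
      fun y => by simp only [Algebra.smul_def, map_sub, sub_mul]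
    rw [hsub, Subalgebra.coe_mul, Subalgebra.coe_sub, Subalgebra.coe_sub, coe_T_smul, coe_T_smul,
      zpow_neg, zpow_neg, zpow_one, zpow_natCast]
    exact ug_E_mul_divPow_F_sub n
  have h' := congrArg (toUq k) h
  rw [toUq_smul, map_sub, map_sub, map_mul, map_mul, map_mul, map_sub, toUq_smul, toUq_smul,
    algebraMap_T, algebraMap_T, algebraMap_T, algebraMap_T, zpow_one, zpow_neg_one] at h'
  exact h'

theorem uqGen_pow_eq_zero {l : ℕ} (hl : 1 < l) (hl' : algebraMap A k (qIntA l) = 0) :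
    uqGen k .E ^ l = 0 ∧ uqGen k .F ^ l = 0 := by
  have hf : algebraMap A k (qFactA l) = 0 := by
    rw [qFactA, map_prod]
    refine Finset.prod_eq_zero (i := l - 1) (Finset.mem_range.mpr (by omega)) ?_
    rwa [Nat.sub_add_cancel (by omega)]
  have hE : genU .E ^ l = qFactA l • dividedE l := by
    apply Subtype.ext
    rw [Subalgebra.coe_smul, algebraMap_smul_UQv, algebraMap_qFactA]
    exact (qFact_smul_divPow _ _).symm
  have hF : genU .F ^ l = qFactA l • dividedF l := by
    apply Subtype.ext
    rw [Subalgebra.coe_smul, algebraMap_smul_UQv, algebraMap_qFactA]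
    exact (qFact_smul_divPow _ _).symm
  constructor
  · rw [← toUq_genU, ← map_pow, hE, toUq_smul, hf, zero_smul]
  · rw [← toUq_genU, ← map_pow, hF, toUq_smul, hf, zero_smul]

end Specialized

/-! ### The order of `K` in `U_q` -/

section Straightening

variable {k : Type*} [Field k]

/-- The quantum binomial coefficient at the parameter `a`, defined by Pascal's rule
`b(n+1, t+1) = a⁻ᵗ⁻¹ b(n, t+1) + aⁿ⁻ᵗ b(n, t)`. -/
def qBinom (a : k) : ℕ → ℕ → k
  | 0, 0 => 1
  | 0, _ + 1 => 0
  | _ + 1, 0 => 1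
  | n + 1, t + 1 => a ^ (-(t + 1 : ℤ)) * qBinom a n (t + 1) + a ^ (n - t : ℤ) * qBinom a n t

theorem qBinom_zero_right (a : k) (n : ℕ) : qBinom a n 0 = 1 := by
  cases n <;> rfl

theorem qBinom_eq_zero (a : k) {n t : ℕ} (h : n < t) : qBinom a n t = 0 := by
  induction n generalizing t with
  | zero => obtain ⟨t, rfl⟩ := Nat.exists_eq_succ_of_ne_zero h.ne'; rfl
  | succ n ih =>
    obtain ⟨t, rfl⟩ := Nat.exists_eq_succ_of_ne_zero (by omega : t ≠ 0)
    rw [Nat.succ_eq_add_one, qBinom, ih (by omega), ih (by omega), mul_zero, mul_zero, add_zero]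

theorem qBinom_self (a : k) (n : ℕ) : qBinom a n n = 1 := by
  induction n with
  | zero => rfl
  | succ n ih => rw [qBinom, ih, qBinom_eq_zero a (by omega)]; simp

theorem qBinom_mul_right {a : k} (ha : a ≠ 0) (n t : ℕ) :
    (a ^ (t + 1 : ℤ) - a ^ (-(t + 1 : ℤ))) * qBinom a n (t + 1) =
      (a ^ (n - t : ℤ) - a ^ (-(n - t : ℤ))) * qBinom a n t := by
  have hz : ∀ x y : ℤ, a ^ (x + y) = a ^ x * a ^ y := zpow_add₀ ha
  induction n generalizing t with
  | zero =>
    cases t with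
    | zero => simp [qBinom]
    | succ t => simp [qBinom]
  | succ n ih =>
    cases t with
    | zero =>
      have h := ih 0
      rw [qBinom_zero_right] at h ⊢
      rw [qBinom, qBinom_zero_right]
      push_cast at h ⊢
      simp only [sub_zero, mul_one] at h ⊢
      rw [mul_add, mul_left_comm, h, hz n 1, neg_add, hz (-n) (-1)]
      have : a ^ (1 : ℤ) * a ^ (-1 : ℤ) = 1 := by rw [← hz]; simp
      linear_combination (-(a ^ (n : ℤ)))*this + (a ^ (n : ℤ)) * this
    | succ t =>
      have h1 := ih (t + 1)
      have h2 := ih t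
      rw [qBinom, qBinom]
      push_cast at h1 h2 ⊢
      have e1 : ∀ x y : ℤ, a ^ (-x) * (a ^ y - a ^ (-y)) + a ^ y * (a ^ x - a ^ (-x)) =
          a ^ (x + y) - a ^ (-(x + y)) := by
        intro x y
        rw [hz, neg_add, hz]
        ring
      have l1 := e1 (t + 1 + 1) (n - (t + 1))
      have l2 := e1 (t + 1) (n + 1 - (t + 1))
      rw [show (n : ℤ) + 1 - (t + 1) = n - t by ring] at l2 ⊢
      rw [show (t : ℤ) + 1 + (n - t) = n + 1 by ring] at l2
      rw [show (t : ℤ) + 1 + 1 + (n - (t + 1)) = n + 1 by ring] at l1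
      linear_combination a ^ (-((t : ℤ) + 1 + 1)) * h1 + a ^ ((n : ℤ) - t) * h2 +
        qBinom a n (t + 1) * (l1 - l2)

/-- The second form of Pascal's rule. -/
theorem qBinom_succ_succ' {a : k} (ha : a ≠ 0) (n t : ℕ) :
    qBinom a (n + 1) (t + 1) =
      a ^ (t + 1 : ℤ) * qBinom a n (t + 1) + a ^ (-(n - t : ℤ)) * qBinom a n t := by
  rw [qBinom]
  linear_combination -qBinom_mul_right ha n t

/-- The binomials `[l, t]` with `0 < t < l` vanish at an `l`-th root of unity. -/
theorem qBinom_eq_zero_of_pow_eq_one {a : k} (ha : a ≠ 0) {l t : ℕ} (h1 : a ^ l = 1)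
    (ht : 0 < t) (htl : t < l) (h2 : ∀ i, 0 < i → i < l → a ^ i ≠ (a ^ i)⁻¹) :
    qBinom a l t = 0 := by
  obtain ⟨t, rfl⟩ := Nat.exists_eq_succ_of_ne_zero ht.ne'
  induction t with
  | zero =>
    have h := qBinom_mul_right ha l 0
    have h3 := h2 1 one_pos htl
    simp [h1] at h h3
    simpa using h.resolve_left (sub_ne_zero.mpr h3)
  | succ t ih =>
    have h := qBinom_mul_right ha l (t + 1)
    rw [ih (by omega) (by omega), mul_zero] at h
    refine (mul_eq_zero.mp h).resolve_left (sub_ne_zero.mpr ?_)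
    have h3 := h2 (t + 1 + 1) (by omega) htl
    rw [zpow_neg]
    exact_mod_cast h3

variable {B : Type*} [Ring B] [Algebra k B]

/-- `[K; c] = (aᶜ K - a⁻ᶜ K⁻¹) / (a - a⁻¹)`. -/
def torusFactor (a : k) (K K' : B) (c : ℤ) : B :=
  (a - a⁻¹)⁻¹ • (a ^ c • K - a ^ (-c) • K')

/-- The product `[K; c] [K; c + 1] ⋯ [K; c + t - 1]`. -/
def torusProd (a : k) (K K' : B) (c : ℤ) : ℕ → B
  | 0 => 1
  | t + 1 => torusProd a K K' c t * torusFactor a K K' (c + t)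

theorem torusProd_succ' (a : k) (K K' : B) (c : ℤ) (t : ℕ) :
    torusProd a K K' c (t + 1) = torusFactor a K K' c * torusProd a K K' (c + 1) t := by
  induction t generalizing c with
  | zero => simp [torusProd]
  | succ t ih =>
    rw [torusProd, ih, torusProd, mul_assoc]
    congr 3
    push_cast; ring

theorem torusFactor_commute (a : k) {K K' : B} (h : Commute K K') (c d : ℤ) :
    Commute (torusFactor a K K' c) (torusFactor a K K' d) := by
  unfold torusFactor
  refine ((Commute.smul_left (Commute.smul_right ?_ _) _))
  exact (((Commute.refl K).smul_right _ |>.sub_right (h.smul_right _)).smul_left _).sub_left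
    ((h.symm.smul_right _ |>.sub_right ((Commute.refl K').smul_right _)).smul_left _)

theorem torusFactor_commute_torusProd (a : k) {K K' : B} (h : Commute K K') (c d : ℤ) (t : ℕ) :
    Commute (torusFactor a K K' c) (torusProd a K K' d t) := by
  induction t with
  | zero => exact Commute.one_right _
  | succ t ih => exact ih.mul_right (torusFactor_commute a h _ _)

theorem mul_torusProd {a : k} {K K' E : B}
    (h : ∀ c, E * torusFactor a K K' c = torusFactor a K K' (c - 2) * E) (c : ℤ) (t : ℕ) :
    E * torusProd a K K' c t = torusProd a K K' (c - 2) t * E := by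
  induction t with
  | zero => simp [torusProd]
  | succ t ih =>
    rw [torusProd, torusProd, ← mul_assoc, ih, mul_assoc, h, ← mul_assoc]
    congr 3; ring

/-- The straightening formula for `Eⁿ F⁽ᵐ⁾`. Here `F i` plays the part of the divided power
`F⁽ⁱ⁾`. -/
theorem pow_mul_eq_sum {a : k} (ha : a ≠ 0) {K K' E : B} {F : ℕ → B} (hK : Commute K K')
    (hE : ∀ c, E * torusFactor a K K' c = torusFactor a K K' (c - 2) * E)
    (hEF : ∀ i : ℕ, E * F (i + 1) = F (i + 1) * E + F i * torusFactor a K K' (-i)) {m n : ℕ}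
    (hn : n ≤ m) :
    E ^ n * F m = ∑ t ∈ Finset.range (n + 1),
      qBinom a n t • (F (m - t) * torusProd a K K' (t + 1 - n - m) t * E ^ (n - t)) := by
  induction n with
  | zero => simp [qBinom, torusProd]
  | succ n ih =>
    have step : ∀ t ∈ Finset.range (n + 1),
        E * (qBinom a n t • (F (m - t) * torusProd a K K' (t + 1 - n - m) t * E ^ (n - t))) =
        qBinom a n t • (F (m - t) * torusProd a K K' (t - 1 - n - m) t * E ^ (n + 1 - t)) +
        qBinom a n t • (F (m - (t + 1)) * (torusFactor a K K' (t + 1 - m) *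
          torusProd a K K' (t + 1 - n - m) t) * E ^ (n - t)) := by
      intro t ht
      have ht' : t ≤ n := Nat.lt_succ_iff.mp (Finset.mem_range.mp ht)
      have e1 := hEF (m - (t + 1))
      rw [show m - (t + 1) + 1 = m - t by omega] at e1
      rw [mul_smul_comm, ← smul_add, ← mul_assoc, ← mul_assoc, e1, add_mul, add_mul,
        mul_assoc (F (m - t)) E, mul_torusProd hE, show n + 1 - t = (n - t) + 1 by omega,
        pow_succ' E (n - t)]
      rw [show (t : ℤ) + 1 - n - m - 2 = t - 1 - n - m by ring,
        show (-((m - (t + 1) : ℕ) : ℤ)) = t + 1 - m by omega]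
      simp only [mul_assoc]
    have key : ∀ t : ℕ, qBinom a n (t + 1) • torusProd a K K' ((t + 1 : ℕ) - 1 - n - m) (t + 1) +
        qBinom a n t • (torusFactor a K K' (t + 1 - m) * torusProd a K K' (t + 1 - n - m) t) =
        qBinom a (n + 1) (t + 1) •
          torusProd a K K' ((t + 1 : ℕ) + 1 - (n + 1 : ℕ) - m) (t + 1) := by
      intro t
      rw [torusProd_succ', show ((t + 1 : ℕ) : ℤ) + 1 - (n + 1 : ℕ) - m = t + 1 - n - m by
        push_cast; ring, torusProd, ← (torusFactor_commute_torusProd a hK _ _ t).eq,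
        show ((t + 1 : ℕ) : ℤ) - 1 - n - m + 1 = t + 1 - n - m by push_cast; ring]
      simp only [← smul_mul_assoc, ← add_mul]
      congr 1
      simp only [torusFactor]
      rw [smul_comm, smul_comm (qBinom a n t), smul_comm (qBinom a (n + 1) (t + 1)), ← smul_add]
      congr 1
      simp only [smul_sub, smul_smul]
      have hz : ∀ x y : ℤ, a ^ (x + y) = a ^ x * a ^ y := zpow_add₀ ha
      have c1 : qBinom a n (t + 1) * a ^ (((t + 1 : ℕ) : ℤ) - 1 - n - m) +
          qBinom a n t * a ^ ((t : ℤ) + 1 - m) =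
          qBinom a (n + 1) (t + 1) * a ^ ((t : ℤ) + 1 - n - m + t) := by
        rw [qBinom, add_mul, mul_right_comm, mul_right_comm (a ^ ((n : ℤ) - t)), ← hz, ← hz]
        push_cast
        ring_nf
      have c2 : qBinom a n (t + 1) * a ^ (-(((t + 1 : ℕ) : ℤ) - 1 - n - m)) +
          qBinom a n t * a ^ (-((t : ℤ) + 1 - m)) =
          qBinom a (n + 1) (t + 1) * a ^ (-((t : ℤ) + 1 - n - m + t)) := by
        rw [qBinom_succ_succ' ha, add_mul, mul_right_comm, mul_right_comm (a ^ (-((n : ℤ) - t))),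
          ← hz, ← hz]
        push_cast
        ring_nf
      rw [← c1, ← c2, add_smul, add_smul]
      abel
    rw [pow_succ', mul_assoc, ih (by omega), Finset.mul_sum, Finset.sum_congr rfl step,
      Finset.sum_add_distrib, Finset.sum_range_succ', Finset.sum_range_succ' _ (n + 1),
      add_right_comm, ]
    congr 1
    · have : ∑ t ∈ Finset.range n, qBinom a n (t + 1) • (F (m - (t + 1)) *
          torusProd a K K' ((t + 1 : ℕ) - 1 - n - m) (t + 1) * E ^ (n + 1 - (t + 1))) =
          ∑ t ∈ Finset.range (n + 1), qBinom a n (t + 1) • (F (m - (t + 1)) *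
          torusProd a K K' ((t + 1 : ℕ) - 1 - n - m) (t + 1) * E ^ (n + 1 - (t + 1))) := by
        rw [Finset.sum_range_succ, qBinom_eq_zero a (by omega : n < n + 1), zero_smul, add_zero]
      rw [this, ← Finset.sum_add_distrib]
      refine Finset.sum_congr rfl fun t _ => ?_
      have h := congrArg (fun x => F (m - (t + 1)) * x * E ^ (n - t)) (key t)
      simp only [mul_add, add_mul, mul_smul_comm, smul_mul_assoc] at h
      rw [Nat.add_sub_add_right, h]
    · simp [qBinom_zero_right, torusProd]

theorem torusProd_mul_pow {a : k} (ha : a ≠ 0) {K K' : B} (hK : K' * K = 1) (hK' : Commute K K')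
    (c : ℤ) (t : ℕ) :
    torusProd a K K' c t * K ^ t = Polynomial.aeval (K ^ 2) (∏ i ∈ Finset.range t,
      (Polynomial.C ((a - a⁻¹)⁻¹ * a ^ (c + i)) *
        (Polynomial.X - Polynomial.C (a ^ (-2 * (c + i)))))) := by
  induction t with
  | zero => simp [torusProd]
  | succ t ih =>
    have h1 : torusFactor a K K' (c + t) * K = Polynomial.aeval (K ^ 2)
        (Polynomial.C ((a - a⁻¹)⁻¹ * a ^ (c + t)) *
        (Polynomial.X - Polynomial.C (a ^ (-2 * (c + t))))) := by
      rw [map_mul, map_sub, Polynomial.aeval_C, Polynomial.aeval_C, Polynomial.aeval_X,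
        torusFactor, smul_mul_assoc, sub_mul, smul_mul_assoc, smul_mul_assoc, hK, map_mul,
        mul_assoc, ← Algebra.smul_def, mul_sub, ← map_mul, ← zpow_add₀ ha, ← Algebra.smul_def,
        ← sq, Algebra.algebraMap_eq_smul_one]
      congr 4
      ring
    rw [Finset.prod_range_succ, map_mul, ← ih, ← h1, torusProd, pow_succ']
    have h2 : Commute (torusFactor a K K' (c + t)) K := by
      refine Commute.smul_left ?_ _
      exact ((Commute.refl K).smul_left _).sub_left (hK'.symm.smul_left _)
    rw [mul_assoc, mul_assoc, ← pow_succ', pow_succ, ← mul_assoc _ (K ^ t), (h2.pow_right t).eq]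
    simp only [mul_assoc]

/-- If `E` is nilpotent of order `l`, the straightening formula for `Eˡ F⁽ˡ⁾` at an `l`-th root of
unity reduces to its last term, `∏ [K; -i] = 0`, and `[K; 0] ⋯ [K; 1 - l]` is a multiple of
`Kˡ - K⁻ˡ`. -/
theorem pow_two_mul_eq_one {a : k} {l : ℕ} (hl : 1 < l) (hodd : Odd l) (ha : IsPrimitiveRoot a l)
    {K K' E : B} {F : ℕ → B} (hK : K' * K = 1) (hK' : K * K' = 1)
    (hE : ∀ c, E * torusFactor a K K' c = torusFactor a K K' (c - 2) * E) (hE0 : E ^ l = 0)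
    (hF0 : F 0 = 1)
    (hEF : ∀ i : ℕ, E * F (i + 1) = F (i + 1) * E + F i * torusFactor a K K' (-i)) :
    K ^ (2 * l) = 1 := by
  have ha0 : a ≠ 0 := ha.ne_zero (by omega)
  have hcomm : Commute K K' := hK'.trans hK.symm
  have hinv : ∀ i, 0 < i → i < l → a ^ i ≠ (a ^ i)⁻¹ := by
    intro i hi hil h
    have h1 : a ^ (2 * i) = 1 := by
      rw [two_mul, pow_add]; nth_rw 1 [h]; exact inv_mul_cancel₀ (pow_ne_zero _ ha0)
    have h2 := (ha.pow_eq_one_iff_dvd _).mp h1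
    have h3 := (Nat.Coprime.dvd_mul_left (Nat.coprime_two_right.mpr hodd)).mp h2
    exact absurd (Nat.le_of_dvd hi h3) (by omega)
  have h1 := pow_mul_eq_sum ha0 hcomm hE hEF (le_refl l)
  rw [hE0, zero_mul, Finset.sum_range_succ, Finset.sum_eq_zero, qBinom_self, Nat.sub_self, hF0,
    pow_zero, mul_one, one_mul, zero_add, one_smul] at h1
  swap
  · intro t ht
    rcases Nat.eq_zero_or_pos t with rfl | ht'
    · rw [Nat.sub_zero, hE0, mul_zero, smul_zero]
    · rw [qBinom_eq_zero_of_pow_eq_one ha0 ha.pow_eq_one ht' (Finset.mem_range.mp ht) hinv,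
        zero_smul]
  have h2 := torusProd_mul_pow ha0 hK hcomm (l + 1 - l - l) l
  rw [← h1, zero_mul, Finset.prod_mul_distrib, map_mul] at h2
  have hh : a - a⁻¹ ≠ 0 := by
    have := hinv 1 one_pos hl
    rw [pow_one] at this
    exact sub_ne_zero.mpr this
  have hunit : IsUnit (∏ i ∈ Finset.range l,
      Polynomial.C ((a - a⁻¹)⁻¹ * a ^ ((l + 1 - l - l : ℤ) + i))) := by
    rw [← map_prod]
    refine (IsUnit.mk0 _ (Finset.prod_ne_zero_iff.mpr fun i _ => ?_)).map Polynomial.C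
    exact mul_ne_zero (inv_ne_zero hh) (zpow_ne_zero _ ha0)
  have h3 : Polynomial.aeval (K ^ 2) (∏ i ∈ Finset.range l,
      (Polynomial.X - Polynomial.C (a ^ (-2 * ((l + 1 - l - l : ℤ) + i))))) = 0 :=
    ((hunit.map (Polynomial.aeval (K ^ 2))).mul_right_eq_zero).mp h2.symm
  have hdvd : (∏ i ∈ Finset.range l,
      (Polynomial.X - Polynomial.C (a ^ (-2 * ((l + 1 - l - l : ℤ) + i))))) ∣
      (Polynomial.X ^ l - 1 : Polynomial k) := by
    refine Finset.prod_dvd_of_coprime ?_ ?_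
    · intro i hi j hj hij
      refine Polynomial.isCoprime_X_sub_C_of_isUnit_sub (IsUnit.mk0 _ (sub_ne_zero.mpr fun h => ?_))
      have h4 : a ^ (2 * ((j : ℤ) - i)) = 1 := by
        rw [← div_eq_one_iff_eq (zpow_ne_zero _ ha0), ← zpow_sub₀ ha0] at h
        rw [← h]; congr 1; ring
      have h5 := (ha.zpow_eq_one_iff_dvd _).mp h4
      have h6 : (l : ℤ) ∣ (j : ℤ) - i := by
        refine IsCoprime.dvd_of_dvd_mul_left ?_ h5
        exact_mod_cast Nat.isCoprime_iff_coprime.mpr (Nat.coprime_two_right.mpr hodd)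
      have hi' := Finset.mem_range.mp hi
      have hj' := Finset.mem_range.mp hj
      have h7 := Int.eq_zero_of_abs_lt_dvd h6 (by rw [abs_lt]; omega)
      omega
    · intro i _
      rw [Polynomial.dvd_iff_isRoot, Polynomial.IsRoot, Polynomial.eval_sub, Polynomial.eval_pow,
        Polynomial.eval_X, Polynomial.eval_one, ← zpow_natCast, ← zpow_mul, mul_comm, zpow_mul,
        zpow_natCast, ha.pow_eq_one, one_zpow, sub_self]
  obtain ⟨g, hg⟩ := hdvd
  have h8 := congrArg (Polynomial.aeval (K ^ 2)) hg
  rw [map_mul, h3, zero_mul, map_sub, map_pow, Polynomial.aeval_X, map_one, ← pow_mul] at h8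
  exact sub_eq_zero.mp h8

end Straightening

/-! ### Relations in the small quantum group -/

section Specialized

variable (k : Type*) [Field k] [Algebra A k]

/-- The parameter `q - q⁻¹` of the commutation relation. -/
def qDiff : k := q k - (q k)⁻¹

variable {l : ℕ}

theorem zpow_eq_one_iff (hq : IsPrimitiveRoot (q k) l) (n : ℤ) : q k ^ n = 1 ↔ (l : ℤ) ∣ n :=
  hq.zpow_eq_one_iff_dvd n

theorem qDiff_ne_zero (hl : 1 < l) (hodd : Odd l) (hq : IsPrimitiveRoot (q k) l) :
    qDiff k ≠ 0 := by
  intro h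
  have h1 : q k ^ 2 = 1 := by
    have h2 := sub_eq_zero.mp h
    rw [sq]; nth_rw 1 [h2]; exact inv_mul_cancel₀ (q_ne_zero k)
  have h2 := Nat.le_of_dvd two_pos ((hq.pow_eq_one_iff_dvd _).mp h1)
  obtain ⟨c, rfl⟩ := hodd
  omega

theorem algebraMap_qIntA_eq_zero (hl : 1 < l) (hodd : Odd l) (hq : IsPrimitiveRoot (q k) l) :
    algebraMap A k (qIntA l) = 0 := by
  have h := mul_algebraMap_qIntA (B := k) l
  change qDiff k * _ = q k ^ l - (q k ^ l)⁻¹ at h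
  rw [hq.pow_eq_one, inv_one, sub_self] at h
  exact (mul_eq_zero.mp h).resolve_left (qDiff_ne_zero k hl hodd hq)

theorem E_pow_eq_zero (hl : 1 < l) (hodd : Odd l) (hq : IsPrimitiveRoot (q k) l) :
    E k ^ l = 0 :=
  Subtype.ext (uqGen_pow_eq_zero k hl (algebraMap_qIntA_eq_zero k hl hodd hq)).1

theorem F_pow_eq_zero (hl : 1 < l) (hodd : Odd l) (hq : IsPrimitiveRoot (q k) l) :
    F k ^ l = 0 :=
  Subtype.ext (uqGen_pow_eq_zero k hl (algebraMap_qIntA_eq_zero k hl hodd hq)).2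

theorem uqGen_E_mul_Kinv :
    uqGen k .E * uqGen k .Kinv = q k ^ (2 : ℤ) • (uqGen k .Kinv * uqGen k .E) := by
  calc uqGen k .E * uqGen k .Kinv
      = uqGen k .Kinv * (uqGen k .K * uqGen k .E) * uqGen k .Kinv := by
        rw [← mul_assoc (uqGen k .Kinv), uqGen_Kinv_mul_K, one_mul]
    _ = q k ^ (2 : ℤ) • (uqGen k .Kinv * uqGen k .E) := by
        rw [uqGen_K_mul_E, mul_smul_comm, smul_mul_assoc, mul_assoc, mul_assoc,
          uqGen_K_mul_Kinv, mul_one]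

theorem uqGen_K_pow_two_mul (hl : 1 < l) (hodd : Odd l) (hq : IsPrimitiveRoot (q k) l) :
    uqGen k .K ^ (2 * l) = 1 := by
  have h0 := q_ne_zero k
  have hd := qDiff_ne_zero k hl hodd hq
  refine pow_two_mul_eq_one hl hodd hq (E := uqGen k .E) (K' := uqGen k .Kinv)
    (F := fun i => toUq k (dividedF i)) (uqGen_Kinv_mul_K k) (uqGen_K_mul_Kinv k) ?_
    (uqGen_pow_eq_zero k hl (algebraMap_qIntA_eq_zero k hl hodd hq)).1 ?_ ?_
  · intro c
    unfold torusFactor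
    rw [mul_smul_comm, smul_mul_assoc, mul_sub, sub_mul, mul_smul_comm, mul_smul_comm,
      smul_mul_assoc, smul_mul_assoc, uqGen_K_mul_E, uqGen_E_mul_Kinv, smul_smul, smul_smul,
      ← zpow_add₀ h0, ← zpow_add₀ h0]
    ring_nf
  · simp only [dividedF_zero, map_one]
  · intro i
    have h := uqGen_E_mul_dividedF_sub k i
    change qDiff k • _ = _ at h
    have h2 := congrArg (fun x => (qDiff k)⁻¹ • x) h
    simp only [smul_smul] at h2
    rw [inv_mul_cancel₀ hd, one_smul, sub_eq_iff_eq_add'] at h2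
    rw [h2, torusFactor, mul_smul_comm, neg_neg]
    rfl

theorem K_pow_two_mul (hl : 1 < l) (hodd : Odd l) (hq : IsPrimitiveRoot (q k) l) :
    K k ^ (2 * l) = 1 :=
  Subtype.ext (uqGen_K_pow_two_mul k hl hodd hq)

theorem K_mul_E : K k * E k = q k ^ (2 : ℤ) • (E k * K k) := Subtype.ext (uqGen_K_mul_E k)

theorem K_mul_F : K k * F k = q k ^ (-2 : ℤ) • (F k * K k) := by
  apply Subtype.ext
  have h := uqGen_K_mul_dividedF k 1
  rw [dividedF_one, toUq_genU] at h
  exact h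

theorem uqGen_Kinv_eq (hl : 1 < l) (hodd : Odd l) (hq : IsPrimitiveRoot (q k) l) :
    uqGen k .Kinv = uqGen k .K ^ (2 * l - 1) := by
  rw [← one_mul (uqGen k .Kinv), ← uqGen_K_pow_two_mul k hl hodd hq,
    show 2 * l = 2 * l - 1 + 1 by omega, pow_succ, mul_assoc, uqGen_K_mul_Kinv, mul_one,
    Nat.add_sub_cancel]

theorem qDiff_smul_E_mul_F_sub (hl : 1 < l) (hodd : Odd l) (hq : IsPrimitiveRoot (q k) l) :
    qDiff k • (E k * F k - F k * E k) = K k - K k ^ (2 * l - 1) := by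
  apply Subtype.ext
  have h := uqGen_E_mul_dividedF_sub k 0
  rw [zero_add, dividedF_one, dividedF_zero, map_one, toUq_genU, uqGen_Kinv_eq k hl hodd hq] at h
  simp only [Nat.cast_zero, neg_zero, zpow_zero, one_smul, one_mul] at h
  exact h

end Specialized

/-! ### Simple modules of `U` and highest weight vectors over the small quantum group -/

section Matrices

variable {B : Type*} [CommRing B] (a : ℕ)

/-- The matrix `x_j ↦ c_j x_{j-1}` on `x_0, …, x_a`. -/
def raising (c : ℕ → B) : Matrix (Fin (a + 1)) (Fin (a + 1)) B :=
  Matrix.of fun i j => if (i : ℕ) + 1 = j then c j else 0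

/-- The matrix `x_j ↦ x_{j+1}` on `x_0, …, x_a`. -/
def lowering : Matrix (Fin (a + 1)) (Fin (a + 1)) B :=
  Matrix.of fun i j => if (j : ℕ) + 1 = i then 1 else 0

variable {a}

theorem raising_mul_lowering {c : ℕ → B} (hc : c (a + 1) = 0) :
    raising a c * lowering a = Matrix.diagonal fun i : Fin (a + 1) => c (i + 1) := by
  ext i j
  simp only [raising, lowering, Matrix.mul_apply, Matrix.of_apply, Matrix.diagonal_apply]
  by_cases hi : (i : ℕ) = a
  · rw [hi, hc, ite_self]
    refine Finset.sum_eq_zero fun x _ => ?_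
    rw [if_neg (by omega), zero_mul]
  · rw [Finset.sum_eq_single (⟨i + 1, by omega⟩ : Fin (a + 1))]
    · simp [Fin.ext_iff, eq_comm]
    · intro x _ hx
      rw [if_neg (fun h => hx (Fin.ext h.symm)), zero_mul]
    · simp

theorem lowering_mul_raising {c : ℕ → B} (hc : c 0 = 0) :
    lowering a * raising a c = Matrix.diagonal fun i : Fin (a + 1) => c i := by
  ext i j
  simp only [raising, lowering, Matrix.mul_apply, Matrix.of_apply, Matrix.diagonal_apply]
  by_cases hi : (i : ℕ) = 0
  · rw [hi, hc, ite_self]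
    refine Finset.sum_eq_zero fun x _ => ?_
    rw [if_neg (by omega), zero_mul]
  · rw [Finset.sum_eq_single (⟨i - 1, by omega⟩ : Fin (a + 1))]
    · simp only [Fin.ext_iff]
      rw [if_pos (by omega), one_mul]
      by_cases h : (i : ℕ) = j
      · rw [if_pos h, if_pos (by omega), h]
      · rw [if_neg h, if_neg (by omega)]
    · intro x _ hx
      rw [if_neg (fun h => hx (Fin.ext (show (x : ℕ) = i - 1 by omega))), zero_mul]
    · simp

theorem raising_pow_eq_zero (c : ℕ → B) {n : ℕ} (hn : a < n) : raising a c ^ n = 0 := by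
  have h : ∀ (n : ℕ) (i j : Fin (a + 1)), (i : ℕ) + n ≠ j → (raising a c ^ n) i j = 0 := by
    intro n
    induction n with
    | zero => intro i j hij; exact Matrix.one_apply_ne fun h => hij (by rw [h, add_zero])
    | succ n ih =>
      intro i j hij
      rw [pow_succ, Matrix.mul_apply]
      refine Finset.sum_eq_zero fun x _ => ?_
      by_cases hx : (i : ℕ) + n = x
      · rw [raising, Matrix.of_apply, if_neg (by omega), mul_zero]
      · rw [ih i x hx, zero_mul]
  ext i j
  exact h n i j (by omega)

theorem lowering_pow_eq_zero {n : ℕ} (hn : a < n) :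
    (lowering a ^ n : Matrix (Fin (a + 1)) (Fin (a + 1)) B) = 0 := by
  have h : (lowering a : Matrix (Fin (a + 1)) (Fin (a + 1)) B) = (raising a fun _ => 1).transpose := by
    ext i j; rfl
  rw [h, ← Matrix.transpose_pow, raising_pow_eq_zero _ hn, Matrix.transpose_zero]

end Matrices

/-- `[j] [a - j + 1]`, the coefficient of `x_{j-1}` in `E x_j`, where `x_j = Fʲ x_0` and `x_0` has
highest weight `a`. -/
def raisingCoeff (a j : ℕ) : A := qIntA j * qIntA (a + 1 - j)

/-- The generators acting on the simple `U`-module of dimension `a + 1`. -/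
def simpleGen (a : ℕ) : Gen → Matrix (Fin (a + 1)) (Fin (a + 1)) A
  | .E => raising a (raisingCoeff a)
  | .F => lowering a
  | .K => Matrix.diagonal fun i => LaurentPolynomial.T (a - 2 * i)
  | .Kinv => Matrix.diagonal fun i => LaurentPolynomial.T (-(a - 2 * i))

theorem qIntA_zero : qIntA 0 = 0 := by simp [qIntA]

theorem algebraMap_raisingCoeff_sub {a i : ℕ} (hi : i ≤ a) :
    algebraMap A Qv (raisingCoeff a (i + 1)) - algebraMap A Qv (raisingCoeff a i) =
      (v - v⁻¹)⁻¹ * (v ^ (a - 2 * i : ℤ) - v ^ (-(a - 2 * i : ℤ))) := by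
  have hv := v_ne_zero
  have hh := v_sub_inv_ne_zero
  obtain ⟨b, rfl⟩ := Nat.exists_eq_add_of_le hi
  simp only [raisingCoeff, map_mul, algebraMap_qIntA]
  rw [show i + b + 1 - (i + 1) = b by omega, show i + b + 1 - i = b + 1 by omega,
    show ((i + b : ℕ) : ℤ) - 2 * i = b - i by push_cast; ring, neg_sub, zpow_sub₀ hv,
    zpow_sub₀ hv, zpow_natCast, zpow_natCast]
  have h3 : v ^ 2 - 1 ≠ 0 := by
    intro h; apply hh; field_simp; rw [h, mul_zero]
  unfold qInt
  field_simp
  ring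

/-- The images of the generators satisfy the defining relations. -/
theorem simpleGen_rel (a : ℕ) ⦃x y : Free⦄ (h : Rel x y) :
    FreeAlgebra.lift Qv (fun g => (simpleGen a g).map (algebraMap A Qv)) x =
      FreeAlgebra.lift Qv (fun g => (simpleGen a g).map (algebraMap A Qv)) y := by
  have hv := v_ne_zero
  have hT : ∀ n, algebraMap A Qv (LaurentPolynomial.T n) = v ^ n := algebraMap_T_eq_zpow
  have hK : (simpleGen a .K).map (algebraMap A Qv) =
      Matrix.diagonal fun i : Fin (a + 1) => v ^ (a - 2 * i : ℤ) := by
    rw [simpleGen, Matrix.diagonal_map (map_zero _)]; simp only [hT]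
  have hKi : (simpleGen a .Kinv).map (algebraMap A Qv) =
      Matrix.diagonal fun i : Fin (a + 1) => v ^ (-(a - 2 * i) : ℤ) := by
    rw [simpleGen, Matrix.diagonal_map (map_zero _)]; simp only [hT]
  have hmul : ∀ M N : Matrix (Fin (a + 1)) (Fin (a + 1)) A,
      M.map (algebraMap A Qv) * N.map (algebraMap A Qv) = (M * N).map (algebraMap A Qv) :=
    fun M N => Matrix.map_mul.symm
  cases h with
  | K_Kinv =>
    simp only [map_mul, map_one, FreeAlgebra.lift_ι_apply, hK, hKi, Matrix.diagonal_mul_diagonal,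
      ← zpow_add₀ hv, add_neg_cancel, zpow_zero, Matrix.diagonal_one]
  | Kinv_K =>
    simp only [map_mul, map_one, FreeAlgebra.lift_ι_apply, hK, hKi, Matrix.diagonal_mul_diagonal,
      ← zpow_add₀ hv, neg_add_cancel, zpow_zero, Matrix.diagonal_one]
  | K_E =>
    simp only [map_mul, map_smul, FreeAlgebra.lift_ι_apply, hK]
    ext i j
    simp only [Matrix.diagonal_mul, Matrix.smul_apply, Matrix.mul_diagonal, Matrix.map_apply,
      simpleGen, raising, Matrix.of_apply, smul_eq_mul]
    split_ifs with h
    · rw [mul_left_comm, mul_comm, ← h, ← zpow_natCast, ← zpow_add₀ hv]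
      congr 2; push_cast; ring
    · simp
  | K_F =>
    simp only [map_mul, map_smul, FreeAlgebra.lift_ι_apply, hK]
    ext i j
    simp only [Matrix.diagonal_mul, Matrix.smul_apply, Matrix.mul_diagonal, Matrix.map_apply,
      simpleGen, lowering, Matrix.of_apply, smul_eq_mul]
    split_ifs with h
    · rw [mul_left_comm, mul_comm, ← h, ← zpow_natCast, ← zpow_neg, ← zpow_add₀ hv]
      congr 2; push_cast; ring
    · simp
  | E_F =>
    simp only [map_sub, map_mul, map_smul, FreeAlgebra.lift_ι_apply, hmul]
    rw [hK, hKi, simpleGen, simpleGen, raising_mul_lowering (by simp [raisingCoeff, qIntA_zero]),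
      lowering_mul_raising (by simp [raisingCoeff, qIntA_zero]), Matrix.diagonal_map (map_zero _),
      Matrix.diagonal_map (map_zero _), Matrix.diagonal_sub, Matrix.diagonal_sub,
      ← Matrix.diagonal_smul]
    congr 1
    funext i
    simp only [Pi.smul_apply, smul_eq_mul]
    exact algebraMap_raisingCoeff_sub (Nat.lt_succ_iff.mp i.2)

/-- The simple module of dimension `a + 1` over the quantum group over `ℚ(v)`. -/
def simpleRep (a : ℕ) : UQv →ₐ[Qv] Matrix (Fin (a + 1)) (Fin (a + 1)) Qv :=
  (RingQuot.liftAlgHom Qv (s := Rel) (B := Matrix (Fin (a + 1)) (Fin (a + 1)) Qv))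
    ⟨_, simpleGen_rel a⟩

theorem simpleRep_ug (a : ℕ) (g : Gen) :
    simpleRep a (ug g) = (simpleGen a g).map (algebraMap A Qv) := by
  have h : RingQuot.liftAlgHom Qv (s := Rel) (B := Matrix (Fin (a + 1)) (Fin (a + 1)) Qv)
      ⟨_, simpleGen_rel a⟩ (RingQuot.mkAlgHom Qv Rel (gen g)) =
      FreeAlgebra.lift Qv _ (gen g) := RingQuot.liftAlgHom_mkAlgHom_apply ..
  rw [FreeAlgebra.lift_ι_apply] at h
  exact h

section Specialized

variable (k : Type*) [Field k] [Algebra A k]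

instance : (RingHom.ker (algebraMap A k)).IsPrime := RingHom.ker_isPrime _

/-- The local ring of `ℤ[v, v⁻¹]` at the kernel of the specialization `v ↦ q`. -/
abbrev LocA : Type := Localization.AtPrime (RingHom.ker (algebraMap A k))

/-- The specialization of the local ring. -/
def locToField : LocA k →ₐ[A] k :=
  IsLocalization.liftAlgHom (M := (RingHom.ker (algebraMap A k)).primeCompl)
    (f := Algebra.ofId A k) fun y => IsUnit.mk0 _ fun h => y.2 h

/-- The inclusion of the local ring into `ℚ(v)`. -/
def locToQv : LocA k →ₐ[A] Qv :=
  IsLocalization.liftAlgHom (M := (RingHom.ker (algebraMap A k)).primeCompl)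
    (f := Algebra.ofId A Qv) fun y => IsUnit.mk0 _ fun h => y.2 <| by
      have h0 : (y : A) = 0 := IsFractionRing.injective A Qv (by rw [map_zero]; exact h)
      rw [h0]; exact zero_mem _

theorem locToQv_injective : Function.Injective (locToQv k) := by
  have h : Function.Injective (locToQv k : LocA k →+* Qv) := by
    refine (IsLocalization.injective_iff_map_algebraMap_eq
      (RingHom.ker (algebraMap A k)).primeCompl _).mpr fun x y => ⟨fun h => by rw [h], fun h => ?_⟩
    have h' : locToQv k (algebraMap A (LocA k) x) = locToQv k (algebraMap A (LocA k) y) := h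
    rw [AlgHom.commutes, AlgHom.commutes] at h'
    rw [IsFractionRing.injective A Qv h']
  exact h

theorem isUnit_loc {x : A} (hx : algebraMap A k x ≠ 0) : IsUnit (algebraMap A (LocA k) x) :=
  IsLocalization.map_units (M := (RingHom.ker (algebraMap A k)).primeCompl) (LocA k)
    ⟨x, fun h => hx h⟩

variable {l : ℕ}

theorem simpleRep_mem_range {a : ℕ} (ha : ∀ n ≤ a, algebraMap A k (qFactA n) ≠ 0) {x : UQv}
    (hx : x ∈ U) :
    simpleRep a x ∈ ((locToQv k).mapMatrix (m := Fin (a + 1))).range := by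
  set R := ((locToQv k).mapMatrix (m := Fin (a + 1))).range
  have hmap : ∀ M : Matrix (Fin (a + 1)) (Fin (a + 1)) A, M.map (algebraMap A Qv) ∈ R := by
    intro M
    refine ⟨M.map (algebraMap A (LocA k)), ?_⟩
    ext i j
    exact (locToQv k).commutes _
  have hdiv : ∀ g, (∀ n, a < n → simpleGen a g ^ n = 0) → ∀ n,
      simpleRep a (divPow (ug g) n) ∈ R := by
    intro g hg n
    rw [divPow, map_smul, map_pow, simpleRep_ug]
    have hpow : (simpleGen a g).map (algebraMap A Qv) ^ n =
      (simpleGen a g ^ n).map (algebraMap A Qv) :=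
      (map_pow (algebraMap A Qv).mapMatrix (simpleGen a g) n).symm
    rw [hpow]
    by_cases hn : a < n
    · rw [hg n hn, Matrix.map_zero _ (map_zero _), smul_zero]
      exact R.zero_mem
    · obtain ⟨c, hc⟩ := (isUnit_loc k (ha n (by omega))).exists_left_inv
      have hc' : (qFact n)⁻¹ = locToQv k c := by
        refine (eq_inv_of_mul_eq_one_left ?_).symm
        rw [← algebraMap_qFactA, ← (locToQv k).commutes, ← map_mul, hc, map_one]
      obtain ⟨M, hM⟩ := hmap (simpleGen a g ^ n)
      refine ⟨c • M, ?_⟩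
      rw [← hM, hc']
      ext i j
      simp
  have h : U ≤ R.comap ((simpleRep a).restrictScalars A) := by
    refine Algebra.adjoin_le ?_
    rintro y ((⟨n, rfl⟩ | ⟨n, rfl⟩) | rfl | rfl)
    · exact hdiv .E (fun n hn => raising_pow_eq_zero _ hn) n
    · exact hdiv .F (fun n hn => lowering_pow_eq_zero hn) n
    · change simpleRep a (ug .K) ∈ R
      rw [simpleRep_ug]; exact hmap _
    · change simpleRep a (ug .Kinv) ∈ R
      rw [simpleRep_ug]; exact hmap _
  exact h hx

/-- For `a < l`, the small quantum group acts on `k^{a+1}` by the specialization of the simple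
`U`-module of dimension `a + 1`. -/
theorem exists_rep {a : ℕ} (ha : ∀ n ≤ a, algebraMap A k (qFactA n) ≠ 0) :
    ∃ ρ : u k →ₐ[k] Matrix (Fin (a + 1)) (Fin (a + 1)) k,
      ρ (E k) = (simpleGen a .E).map (algebraMap A k) ∧
      ρ (K k) = (simpleGen a .K).map (algebraMap A k) := by
  have hinj : Function.Injective ((locToQv k).mapMatrix (m := Fin (a + 1))) := fun M N h => by
    ext i j
    exact locToQv_injective k (congrFun (congrFun h i) j)
  let φ : U →ₐ[A] Matrix (Fin (a + 1)) (Fin (a + 1)) (LocA k) :=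
    (AlgEquiv.ofInjective _ hinj).symm.toAlgHom.comp
      ((((simpleRep a).restrictScalars A).comp U.val).codRestrict _
        fun x => simpleRep_mem_range k ha x.2)
  have hφ : ∀ g, φ (genU g) = (simpleGen a g).map (algebraMap A (LocA k)) := by
    intro g
    apply hinj
    have h1 : (locToQv k).mapMatrix (φ (genU g)) = simpleRep a (ug g) :=
      congrArg Subtype.val ((AlgEquiv.ofInjective _ hinj).apply_symm_apply _)
    rw [h1, simpleRep_ug]
    ext i j
    exact ((locToQv k).commutes _).symm
  let ψ : Uq k →ₐ[k] Matrix (Fin (a + 1)) (Fin (a + 1)) k :=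
    Algebra.TensorProduct.lift (R := A) (S := k) (A := k) (B := U)
      (Algebra.ofId k _) ((locToField k).mapMatrix.comp φ)
      fun x y => Algebra.commutes x _
  have hψ : ∀ g, ψ (uqGen k g) = (simpleGen a g).map (algebraMap A k) := by
    intro g
    have h1 : ψ (uqGen k g) = Algebra.ofId k _ 1 * (locToField k).mapMatrix (φ (genU g)) :=
      Algebra.TensorProduct.lift_tmul ..
    rw [h1, map_one, one_mul, hφ]
    ext i j
    exact (locToField k).commutes _
  exact ⟨ψ.comp (u k).val, hψ .E, hψ .K⟩

theorem qFactA_ne_zero (hodd : Odd l) (hq : IsPrimitiveRoot (q k) l) {n : ℕ}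
    (hn : n < l) : algebraMap A k (qFactA n) ≠ 0 := by
  rw [qFactA, map_prod]
  refine Finset.prod_ne_zero_iff.mpr fun i hi h => ?_
  have hi' := Finset.mem_range.mp hi
  have h1 := mul_algebraMap_qIntA (B := k) (i + 1)
  rw [h, mul_zero, eq_comm, sub_eq_zero] at h1
  change q k ^ (i + 1) = (q k ^ (i + 1))⁻¹ at h1
  have h2 : q k ^ (2 * (i + 1)) = 1 := by
    rw [two_mul, pow_add]; nth_rw 1 [h1]
    exact inv_mul_cancel₀ (pow_ne_zero _ (q_ne_zero k))
  have h3 := (Nat.Coprime.dvd_mul_left (Nat.coprime_two_right.mpr hodd)).mp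
    ((hq.pow_eq_one_iff_dvd _).mp h2)
  exact absurd (Nat.le_of_dvd (by omega) h3) (by omega)

/-- The highest weight vector of `Δ̄_q(a)` is not zero. -/
theorem one_notMem_span (hodd : Odd l) (hq : IsPrimitiveRoot (q k) l) {a : ℕ}
    (ha : a < l) :
    (1 : u k) ∉ Submodule.span (u k) {E k, K k - algebraMap k (u k) (q k ^ (a : ℤ))} := by
  obtain ⟨ρ, hE, hK⟩ := exists_rep k (a := a) fun n hn =>
    qFactA_ne_zero k hodd hq (lt_of_le_of_lt hn ha)
  intro h1
  have h2 : ∀ x ∈ Submodule.span (u k) {E k, K k - algebraMap k (u k) (q k ^ (a : ℤ))},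
      Matrix.mulVec (ρ x) (Pi.single 0 1) = 0 := by
    intro x hx
    induction hx using Submodule.span_induction with
    | mem x hx =>
      rcases hx with rfl | rfl
      · rw [hE]
        ext i
        simp [simpleGen, raising]
      · rw [map_sub, hK, AlgHom.commutes]
        ext i
        rw [Matrix.mulVec_single_one]
        simp only [simpleGen, Matrix.diagonal_map (map_zero (algebraMap A k)), Matrix.col_apply,
          Matrix.sub_apply, Matrix.algebraMap_matrix_apply, Matrix.diagonal_apply]
        split_ifs with h
        · subst h
          simp [algebraMap_T]
        · simp
    | zero => rw [map_zero, Matrix.zero_mulVec]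
    | add x y _ _ hx hy => rw [map_add, Matrix.add_mulVec, hx, hy, add_zero]
    | smul x y _ hy => rw [smul_eq_mul, map_mul, ← Matrix.mulVec_mulVec, hy, Matrix.mulVec_zero]
  have h3 := congrFun (h2 1 h1) 0
  simp at h3

end Specialized

/-! ### Weight vectors and the Casimir element -/

section Specialized

variable (k : Type*) [Field k] [Algebra A k]

/-- The standing assumption on the parameter: `l > 1` is odd and `q` is a primitive `l`-th root of
unity. -/
structure OddRoot (l : ℕ) : Prop where
  one_lt : 1 < l
  odd : Odd l
  prim : IsPrimitiveRoot (q k) l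

variable {k} {l : ℕ}

/-- An induction principle for the algebra generated by `E`, `F` and `K`. -/
theorem u_induction {p : u k → Prop} (hE : p (E k)) (hF : p (F k)) (hK : p (K k))
    (halg : ∀ c, p (algebraMap k (u k) c)) (hadd : ∀ x y, p x → p y → p (x + y))
    (hmul : ∀ x y, p x → p y → p (x * y)) (x : u k) : p x := by
  obtain ⟨x, hx⟩ := x
  refine Algebra.adjoin_induction (p := fun x hx => p ⟨x, hx⟩) ?_ ?_ ?_ ?_ hx
  · rintro y (rfl | rfl | rfl)
    exacts [hE, hF, hK]
  · exact halg
  · intro x y hx hy h1 h2; exact hadd _ _ h1 h2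
  · intro x y hx hy h1 h2; exact hmul _ _ h1 h2

variable (k l) in
/-- The Casimir element, scaled so as to act on a highest weight vector of weight `μ` by
`q^{μ+1} + q^{-μ-1}`. -/
def casimir : u k :=
  qDiff k ^ 2 • (F k * E k) + (q k • K k + (q k)⁻¹ • K k ^ (2 * l - 1))

namespace OddRoot

variable (h : OddRoot k l)

include h

theorem l_pos : 0 < l := lt_trans one_pos h.one_lt

theorem two_mul_l : 2 * l = 2 * l - 1 + 1 := by have := h.l_pos; omega

theorem diff_ne_zero : qDiff k ≠ 0 := qDiff_ne_zero k h.one_lt h.odd h.prim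

theorem K_pow : K k ^ (2 * l) = 1 := K_pow_two_mul k h.one_lt h.odd h.prim

theorem Kinv_mul_K : K k ^ (2 * l - 1) * K k = 1 := by
  rw [← pow_succ, ← h.two_mul_l, h.K_pow]

theorem K_mul_Kinv : K k * K k ^ (2 * l - 1) = 1 := by
  rw [← pow_succ', ← h.two_mul_l, h.K_pow]

theorem Kinv_mul_E : K k ^ (2 * l - 1) * E k = q k ^ (-2 : ℤ) • (E k * K k ^ (2 * l - 1)) := by
  have h1 : K k ^ (2 * l - 1) * (K k * E k) * K k ^ (2 * l - 1) = E k * K k ^ (2 * l - 1) := by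
    rw [← mul_assoc, h.Kinv_mul_K, one_mul]
  rw [← h1, K_mul_E, mul_smul_comm, smul_mul_assoc, smul_smul, ← zpow_add₀ (q_ne_zero k),
    mul_assoc, mul_assoc (E k), h.K_mul_Kinv]
  simp

theorem Kinv_mul_F : K k ^ (2 * l - 1) * F k = q k ^ (2 : ℤ) • (F k * K k ^ (2 * l - 1)) := by
  have h1 : K k ^ (2 * l - 1) * (K k * F k) * K k ^ (2 * l - 1) = F k * K k ^ (2 * l - 1) := by
    rw [← mul_assoc, h.Kinv_mul_K, one_mul]
  rw [← h1, K_mul_F, mul_smul_comm, smul_mul_assoc, smul_smul, ← zpow_add₀ (q_ne_zero k),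
    mul_assoc, mul_assoc (F k), h.K_mul_Kinv]
  simp

theorem E_mul_F : E k * F k = F k * E k + (qDiff k)⁻¹ • (K k - K k ^ (2 * l - 1)) := by
  rw [← qDiff_smul_E_mul_F_sub k h.one_lt h.odd h.prim, smul_smul, inv_mul_cancel₀ h.diff_ne_zero,
    one_smul, add_sub_cancel]

/-- The Casimir element is central. -/
theorem casimir_comm (x : u k) : x * casimir k l = casimir k l * x := by
  have hd := h.diff_ne_zero
  have hq0 := q_ne_zero k
  have hdd : ∀ y : u k, qDiff k ^ 2 • (qDiff k)⁻¹ • y = qDiff k • y := fun y => by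
    rw [smul_smul, sq, mul_assoc, mul_inv_cancel₀ hd, mul_one]
  induction x using u_induction with
  | hE =>
    have h1 : E k * (F k * E k) = F k * E k * E k +
        (qDiff k)⁻¹ • (q k ^ (2 : ℤ) • (E k * K k) -
          q k ^ (-2 : ℤ) • (E k * K k ^ (2 * l - 1))) := by
      rw [← mul_assoc, h.E_mul_F, add_mul, smul_mul_assoc, sub_mul, K_mul_E, h.Kinv_mul_E]
    rw [casimir, mul_add, add_mul, mul_smul_comm, h1, smul_add, hdd, smul_mul_assoc, add_assoc,
      add_mul, mul_add, smul_mul_assoc, smul_mul_assoc, K_mul_E, h.Kinv_mul_E, mul_smul_comm,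
      mul_smul_comm]
    congr 1
    have e1 : q k * q k ^ (2 : ℤ) = qDiff k * q k ^ (2 : ℤ) + q k := by
      rw [qDiff]; field_simp; ring
    have e2 : (q k)⁻¹ * q k ^ (-2 : ℤ) = -(qDiff k * q k ^ (-2 : ℤ)) + (q k)⁻¹ := by
      rw [qDiff, zpow_neg]; field_simp; ring
    simp only [smul_sub, smul_smul, e1, e2, add_smul, neg_smul]
    abel
  | hF =>
    have h1 : F k * E k * F k = F k * (F k * E k) +
        (qDiff k)⁻¹ • (F k * K k - F k * K k ^ (2 * l - 1)) := by
      rw [mul_assoc, h.E_mul_F, mul_add, mul_smul_comm, mul_sub]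
    rw [casimir, mul_add, add_mul, smul_mul_assoc, h1, smul_add, hdd, mul_smul_comm, add_assoc,
      add_mul, mul_add, smul_mul_assoc, smul_mul_assoc, K_mul_F, h.Kinv_mul_F, mul_smul_comm,
      mul_smul_comm]
    congr 1
    have e1 : q k * q k ^ (-2 : ℤ) = -qDiff k + q k := by
      rw [qDiff, zpow_neg]; field_simp; ring
    have e2 : (q k)⁻¹ * q k ^ (2 : ℤ) = qDiff k + (q k)⁻¹ := by
      rw [qDiff]; field_simp; ring
    simp only [smul_sub, smul_smul, e1, e2, add_smul, neg_smul]
    abel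
  | hK =>
    have h1 : K k * (F k * E k) = F k * E k * K k := by
      rw [← mul_assoc, K_mul_F, smul_mul_assoc, mul_assoc, K_mul_E, mul_smul_comm, smul_smul,
        ← zpow_add₀ hq0, mul_assoc]
      simp
    rw [casimir, mul_add, add_mul, mul_smul_comm, smul_mul_assoc, h1, mul_add, add_mul,
      mul_smul_comm, mul_smul_comm, smul_mul_assoc, smul_mul_assoc, h.K_mul_Kinv, h.Kinv_mul_K]
  | halg c => exact Algebra.commutes c _
  | hadd x y hx hy => rw [add_mul, mul_add, hx, hy]
  | hmul x y hx hy => rw [mul_assoc, hy, ← mul_assoc, hx, mul_assoc]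

theorem aeval_casimir_comm (p : Polynomial k) (x : u k) :
    x * Polynomial.aeval (casimir k l) p = Polynomial.aeval (casimir k l) p * x := by
  induction p using Polynomial.induction_on' with
  | add p p' hp hp' => rw [map_add, mul_add, add_mul, hp, hp']
  | monomial n c =>
    rw [Polynomial.aeval_monomial]
    have hc : Commute x (casimir k l) := h.casimir_comm x
    exact (show Commute x (algebraMap k (u k) c) from (Algebra.commutes c x).symm).mul_right (hc.pow_right n)

end OddRoot

variable (k) in
/-- The scalar `q^{μ+1} + q^{-μ-1}` by which the Casimir element acts on a highest weight vector of
weight `μ`. -/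
def casimirValue (μ : ℤ) : k := q k ^ (μ + 1) + q k ^ (-(μ + 1))

theorem OddRoot.dvd_two_mul (h : OddRoot k l) {n : ℤ} : (l : ℤ) ∣ 2 * n ↔ (l : ℤ) ∣ n := by
  refine ⟨fun h1 => IsCoprime.dvd_of_dvd_mul_left ?_ h1, fun h1 => h1.mul_left 2⟩
  exact_mod_cast Nat.isCoprime_iff_coprime.mpr (Nat.coprime_two_right.mpr h.odd)

theorem OddRoot.casimirValue_eq_iff (h : OddRoot k l) {μ ν : ℤ} :
    casimirValue k μ = casimirValue k ν ↔ (l : ℤ) ∣ μ - ν ∨ (l : ℤ) ∣ μ + ν + 2 := by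
  have hq0 := q_ne_zero k
  have key : (casimirValue k μ - casimirValue k ν) * q k ^ (μ + 1) =
      (q k ^ (μ - ν) - 1) * (q k ^ (μ + ν + 2) - 1) := by
    unfold casimirValue
    simp only [sub_mul, add_mul, mul_sub, ← zpow_add₀ hq0, one_mul, mul_one]
    rw [show -(μ + 1) + (μ + 1) = 0 by ring, show ν + 1 + (μ + 1) = μ + ν + 2 by ring,
      show -(ν + 1) + (μ + 1) = μ - ν by ring, show μ - ν + (μ + ν + 2) = μ + 1 + (μ + 1) by ring,
      zpow_zero]
    ring
  rw [← zpow_eq_one_iff k h.prim, ← zpow_eq_one_iff k h.prim, ← sub_eq_zero,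
    ← sub_eq_zero (a := q k ^ (μ - ν)), ← sub_eq_zero (a := q k ^ (μ + ν + 2)), ← mul_eq_zero,
    ← key, mul_eq_zero, or_iff_left (zpow_ne_zero _ hq0)]

variable {M : Type*} [AddCommGroup M] [Module (u k) M] [Module k M] [IsScalarTower k (u k) M]

variable (k) in
/-- `x` has weight `μ`, that is, `K` acts on `x` by `q ^ μ`. -/
def IsWt (x : M) (μ : ℤ) : Prop := K k • x = q k ^ μ • x

theorem IsWt.E_smul {x : M} {μ : ℤ} (hx : IsWt k x μ) : IsWt k (E k • x) (μ + 2) := by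
  unfold IsWt at *
  rw [← mul_smul, K_mul_E, smul_assoc, mul_smul, hx, smul_comm (E k), smul_smul,
    ← zpow_add₀ (q_ne_zero k), add_comm]

theorem IsWt.F_smul {x : M} {μ : ℤ} (hx : IsWt k x μ) : IsWt k (F k • x) (μ - 2) := by
  unfold IsWt at *
  rw [← mul_smul, K_mul_F, smul_assoc, mul_smul, hx, smul_comm (F k), smul_smul,
    ← zpow_add₀ (q_ne_zero k)]
  congr 2; ring

theorem IsWt.E_pow_smul {x : M} {μ : ℤ} (hx : IsWt k x μ) (n : ℕ) :
    IsWt k (E k ^ n • x) (μ + 2 * n) := by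
  induction n with
  | zero => simpa using hx
  | succ n ih =>
    have := ih.E_smul
    rw [pow_succ', mul_smul]
    convert this using 1
    push_cast; ring

theorem IsWt.F_pow_smul {x : M} {μ : ℤ} (hx : IsWt k x μ) (n : ℕ) :
    IsWt k (F k ^ n • x) (μ - 2 * n) := by
  induction n with
  | zero => simpa using hx
  | succ n ih =>
    have := ih.F_smul
    rw [pow_succ', mul_smul]
    convert this using 1
    push_cast; ring

omit [IsScalarTower k (u k) M] in
theorem IsWt.of_dvd {x : M} {μ ν : ℤ} (hx : IsWt k x μ) (h : OddRoot k l) (hd : (l : ℤ) ∣ μ - ν) :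
    IsWt k x ν := by
  unfold IsWt at *
  rw [hx]
  congr 1
  rw [← div_eq_one_iff_eq (zpow_ne_zero _ (q_ne_zero k)), ← zpow_sub₀ (q_ne_zero k)]
  exact (zpow_eq_one_iff k h.prim _).mpr hd

namespace OddRoot

variable (h : OddRoot k l)

include h

theorem Kinv_smul {x : M} {μ : ℤ} (hx : IsWt k x μ) :
    K k ^ (2 * l - 1) • x = q k ^ (-μ) • x := by
  have h1 : q k ^ μ • K k ^ (2 * l - 1) • x = x := by
    rw [← smul_comm, ← hx, ← mul_smul, h.Kinv_mul_K, one_smul]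
  rw [← h1]
  nth_rw 1 [h1]
  rw [smul_smul, ← zpow_add₀ (q_ne_zero k), neg_add_cancel, zpow_zero, one_smul]

theorem casimir_smul {x : M} {μ : ℤ} (hx : IsWt k x μ) :
    casimir k l • x = qDiff k ^ 2 • F k • E k • x + casimirValue k μ • x := by
  have h2 := h.Kinv_smul hx
  unfold IsWt at hx
  rw [casimir, add_smul, add_smul, smul_assoc, smul_assoc, smul_assoc, mul_smul, hx,
    h2, smul_smul (q k), smul_smul (q k)⁻¹, ← add_smul, casimirValue, ← zpow_one_add₀ (q_ne_zero k),
    ← zpow_neg_one, ← zpow_add₀ (q_ne_zero k)]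
  congr 4 <;> ring

omit [Module k M] [IsScalarTower k (u k) M] in
theorem casimir_smul_comm (x : u k) (y : M) : casimir k l • x • y = x • casimir k l • y := by
  rw [← mul_smul, ← mul_smul, h.casimir_comm]

omit [Module k M] [IsScalarTower k (u k) M] in
theorem aeval_smul_comm (p : Polynomial k) (x : u k) (y : M) :
    Polynomial.aeval (casimir k l) p • x • y = x • Polynomial.aeval (casimir k l) p • y := by
  rw [← mul_smul, ← mul_smul, h.aeval_casimir_comm]

theorem F_smul_E_smul {x : M} {μ : ℤ} (hx : IsWt k x μ) :
    F k • E k • x = (qDiff k ^ 2)⁻¹ • (casimir k l • x - casimirValue k μ • x) := by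
  rw [h.casimir_smul hx, add_sub_cancel_right, smul_smul (qDiff k ^ 2)⁻¹,
    inv_mul_cancel₀ (pow_ne_zero 2 h.diff_ne_zero), one_smul]

theorem E_smul_F_smul {x : M} {μ : ℤ} (hx : IsWt k x μ) :
    E k • F k • x = (qDiff k ^ 2)⁻¹ • (casimir k l • x - casimirValue k (μ - 2) • x) := by
  have h2 := h.Kinv_smul hx
  have h1 := h.F_smul_E_smul hx
  have hd := h.diff_ne_zero
  unfold IsWt at hx
  rw [← mul_smul, h.E_mul_F, add_smul, mul_smul, h1, smul_assoc, sub_smul, hx, h2, ← sub_smul,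
    smul_smul, smul_sub, smul_sub, smul_smul, smul_smul, sub_add, ← sub_smul]
  congr 2
  have e : qDiff k * (q k ^ μ - q k ^ (-μ)) = casimirValue k μ - casimirValue k (μ - 2) := by
    unfold qDiff casimirValue
    rw [← zpow_neg_one, sub_mul, mul_sub, mul_sub, ← zpow_one_add₀ (q_ne_zero k),
      ← zpow_one_add₀ (q_ne_zero k), ← zpow_add₀ (q_ne_zero k), ← zpow_add₀ (q_ne_zero k)]
    ring_nf
  field_simp
  linear_combination -e

/-- `FⁿEⁿ` acts on a weight vector as a polynomial in the Casimir element. -/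
theorem F_pow_smul_E_pow_smul {x : M} {μ : ℤ} (hx : IsWt k x μ) (n : ℕ) :
    F k ^ n • E k ^ n • x = ((qDiff k ^ 2)⁻¹) ^ n • Polynomial.aeval (casimir k l)
      (∏ i ∈ Finset.range n,
        (Polynomial.X - Polynomial.C (casimirValue k (μ + 2 * i)))) • x := by
  induction n with
  | zero => simp
  | succ n ih =>
    have e1 : F k ^ (n + 1) • E k ^ (n + 1) • x = F k ^ n • F k • E k • E k ^ n • x := by
      rw [pow_succ, pow_succ', mul_smul, mul_smul]
    rw [e1, h.F_smul_E_smul (hx.E_pow_smul n), smul_comm (F k ^ n), smul_sub,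
      ← h.casimir_smul_comm, smul_comm (F k ^ n) (casimirValue k _), ih, Finset.prod_range_succ_comm,
      map_mul, mul_smul, map_sub, Polynomial.aeval_X, Polynomial.aeval_C, sub_smul,
      algebraMap_smul, smul_comm (casimir k l), smul_comm (casimirValue k _), ← smul_sub,
      smul_smul, pow_succ' (qDiff k ^ 2)⁻¹]

/-- `EⁿFⁿ` acts on a highest weight vector by a scalar. -/
theorem E_pow_smul_F_pow_smul {x : M} {μ : ℤ} (hx : IsWt k x μ) (hE : E k • x = 0) (n : ℕ) :
    E k ^ n • F k ^ n • x = (∏ i ∈ Finset.range n, ((qDiff k ^ 2)⁻¹ *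
        (casimirValue k μ - casimirValue k (μ - 2 * i - 2)))) • x := by
  have hC : casimir k l • x = casimirValue k μ • x := by
    rw [h.casimir_smul hx, hE, smul_zero, smul_zero, zero_add]
  induction n with
  | zero => simp
  | succ n ih =>
    have e1 : E k ^ (n + 1) • F k ^ (n + 1) • x = E k ^ n • E k • F k • F k ^ n • x := by
      rw [pow_succ, pow_succ', mul_smul, mul_smul]
    rw [e1, h.E_smul_F_smul (hx.F_pow_smul n), h.casimir_smul_comm, hC, smul_comm (F k ^ n),
      ← sub_smul, smul_smul, smul_comm (E k ^ n), ih, smul_smul, Finset.prod_range_succ_comm]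

/-- If `μ ≡ a` with `0 ≤ a < l` and `n ≤ a`, the scalar by which `EⁿFⁿ` acts on a highest weight
vector of weight `μ` is not zero. -/
theorem exists_E_pow_smul_F_pow_smul {x : M} {a n : ℕ} (ha : a < l) (hn : n ≤ a)
    (hx : IsWt k x a) (hE : E k • x = 0) : ∃ c : k, c ≠ 0 ∧ E k ^ n • F k ^ n • x = c • x := by
  refine ⟨_, ?_, h.E_pow_smul_F_pow_smul hx hE n⟩
  refine Finset.prod_ne_zero_iff.mpr fun i hi => mul_ne_zero
    (inv_ne_zero (pow_ne_zero 2 h.diff_ne_zero)) (sub_ne_zero.mpr fun h1 => ?_)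
  have hi' := Finset.mem_range.mp hi
  rcases h.casimirValue_eq_iff.mp h1 with h2 | h2
  · rw [show (a : ℤ) - (a - 2 * i - 2) = 2 * (i + 1) by ring, h.dvd_two_mul] at h2
    have := Int.le_of_dvd (by omega) h2
    omega
  · rw [show (a : ℤ) + (a - 2 * i - 2) + 2 = 2 * (a - i) by ring, h.dvd_two_mul] at h2
    have := Int.le_of_dvd (by omega) h2
    omega

/-- A module generated by a weight vector `x` is spanned by the vectors `FⁱEʲx`. -/
theorem mem_span_F_pow_E_pow {x : M} {μ : ℤ} (hx : IsWt k x μ) (a : u k) :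
    a • x ∈ Submodule.span k (Set.range fun p : ℕ × ℕ => F k ^ p.1 • E k ^ p.2 • x) := by
  set S := Submodule.span k (Set.range fun p : ℕ × ℕ => F k ^ p.1 • E k ^ p.2 • x)
  have hmem : ∀ i j : ℕ, F k ^ i • E k ^ j • x ∈ S := fun i j => Submodule.subset_span ⟨(i, j), rfl⟩
  have hlin : ∀ b : u k, (∀ i j : ℕ, b • F k ^ i • E k ^ j • x ∈ S) → ∀ y ∈ S, b • y ∈ S := by
    intro b hb y hy
    induction hy using Submodule.span_induction with
    | mem y hy => obtain ⟨p, rfl⟩ := hy; exact hb _ _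
    | zero => rw [smul_zero]; exact S.zero_mem
    | add y z _ _ h1 h2 => rw [smul_add]; exact S.add_mem h1 h2
    | smul c y _ h1 => rw [smul_comm]; exact S.smul_mem c h1
  have main : ∀ b : u k, ∀ y ∈ S, b • y ∈ S := by
    intro b
    induction b using u_induction with
    | hE =>
      refine hlin _ fun i j => ?_
      cases i with
      | zero =>
        rw [pow_zero, one_smul, ← mul_smul, ← pow_succ']
        simpa using hmem 0 (j + 1)
      | succ i =>
        have hw := hx.E_pow_smul j
        rw [pow_succ', mul_smul, h.E_smul_F_smul (hw.F_pow_smul i), h.casimir_smul_comm,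
          h.casimir_smul hw, smul_add, smul_comm (F k ^ i), smul_comm (F k ^ i) (casimirValue k _),
          show F k ^ i • F k • E k • E k ^ j • x = F k ^ (i + 1) • E k ^ (j + 1) • x by
            rw [pow_succ, pow_succ', mul_smul, mul_smul]]
        exact S.smul_mem _ (S.sub_mem (S.add_mem (S.smul_mem _ (hmem _ _))
          (S.smul_mem _ (hmem _ _))) (S.smul_mem _ (hmem _ _)))
    | hF =>
      refine hlin _ fun i j => ?_
      rw [← mul_smul, ← pow_succ']
      exact hmem _ _
    | hK =>
      refine hlin _ fun i j => ?_
      have := (hx.E_pow_smul j).F_pow_smul i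
      unfold IsWt at this
      rw [this]
      exact S.smul_mem _ (hmem _ _)
    | halg c => intro y hy; rw [algebraMap_smul]; exact S.smul_mem c hy
    | hadd b b' hb hb' => intro y hy; rw [add_smul]; exact S.add_mem (hb y hy) (hb' y hy)
    | hmul b b' hb hb' => intro y hy; rw [mul_smul]; exact hb _ (hb' y hy)
  exact main a x (by simpa using hmem 0 0)

/-! ### The weight idempotents -/

theorem sqrtq_sq : sqrtq k l ^ 2 = q k := by
  obtain ⟨c, hc⟩ := h.odd
  have e : (1 - (l : ℤ)) / 2 = -c := by omega
  rw [sqrtq, e, neg_sq, ← zpow_natCast, ← zpow_mul,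
    show -(c : ℤ) * (2 : ℕ) = 1 + l * (-1) by rw [hc]; push_cast; ring,
    zpow_add₀ (q_ne_zero k), zpow_mul, zpow_natCast, h.prim.pow_eq_one]
  simp

theorem kappa'_two_mul (m : ℤ) : kappa' k l (2 * m) =
    ((2 * l : k)⁻¹) • ∑ i ∈ Finset.range (2 * l), (q k ^ (-m) • K k) ^ i := by
  unfold kappa'
  congr 1
  refine Finset.sum_congr rfl fun i _ => ?_
  rw [smul_pow, show -(2 * m * (i : ℤ)) = ((2 : ℕ) : ℤ) * (-m * i) by push_cast; ring, zpow_mul,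
    zpow_natCast, h.sqrtq_sq, zpow_mul, zpow_natCast]

theorem isWt_kappa' (m : ℤ) : IsWt k (kappa' k l (2 * m)) m := by
  have hq0 := q_ne_zero k
  have h1 : (q k ^ (-m) • K k) ^ (2 * l) = 1 := by
    rw [smul_pow, h.K_pow, ← zpow_natCast, ← zpow_mul]
    have : q k ^ (-m * ((2 * l : ℕ) : ℤ)) = 1 :=
      (zpow_eq_one_iff k h.prim _).mpr ⟨-m * 2, by push_cast; ring⟩
    rw [this, one_smul]
  have h2 := mul_geom_sum (q k ^ (-m) • K k) (2 * l)
  rw [h1, sub_self, sub_mul, one_mul, sub_eq_zero, smul_mul_assoc] at h2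
  unfold IsWt
  rw [h.kappa'_two_mul, smul_comm (K k), smul_comm (q k ^ m)]
  congr 1
  nth_rw 2 [← h2]
  rw [smul_smul, ← zpow_add₀ hq0, add_neg_cancel, zpow_zero, one_smul, smul_eq_mul]

theorem sum_smul_of_isWt {x : M} {μ : ℤ} (hx : IsWt k x μ) (m : ℤ) :
    kappa' k l (2 * m) • x = ((2 * l : k)⁻¹ * ∑ i ∈ Finset.range (2 * l), (q k ^ (μ - m)) ^ i) • x := by
  have h1 : ∀ i : ℕ, (q k ^ (-m) • K k) ^ i • x = (q k ^ (μ - m)) ^ i • x := by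
    intro i
    induction i with
    | zero => simp
    | succ i ih =>
      unfold IsWt at hx
      rw [pow_succ, mul_smul, smul_assoc, hx, smul_smul, ← zpow_add₀ (q_ne_zero k),
        smul_comm _ (q k ^ (-m + μ)), ih, smul_smul, pow_succ', neg_add_eq_sub]
  rw [h.kappa'_two_mul, smul_assoc, Finset.sum_smul, Finset.sum_congr rfl fun i _ => h1 i,
    ← Finset.sum_smul, smul_smul]

theorem kappa'_smul_of_isWt [CharZero k] {x : M} {m : ℤ} (hx : IsWt k x m) :
    kappa' k l (2 * m) • x = x := by
  have hl : (l : k) ≠ 0 := Nat.cast_ne_zero.mpr h.l_pos.ne'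
  have h1 : (2 * l : k)⁻¹ * ∑ i ∈ Finset.range (2 * l), (q k ^ (m - m)) ^ i = 1 := by
    simp only [sub_self, zpow_zero, one_pow, Finset.sum_const, Finset.card_range, nsmul_eq_mul,
      mul_one, Nat.cast_mul, Nat.cast_ofNat]
    field_simp
  rw [h.sum_smul_of_isWt hx, h1, one_smul]

theorem kappa'_smul_eq_zero {x : M} {μ m : ℤ} (hx : IsWt k x μ) (hd : ¬ (l : ℤ) ∣ μ - m) :
    kappa' k l (2 * m) • x = 0 := by
  have h1 : q k ^ (μ - m) ≠ 1 := fun h1 => hd ((zpow_eq_one_iff k h.prim _).mp h1)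
  have h2 := mul_geom_sum (q k ^ (μ - m)) (2 * l)
  have h3 : (q k ^ (μ - m)) ^ (2 * l) = 1 := by
    rw [← zpow_natCast, ← zpow_mul]
    exact (zpow_eq_one_iff k h.prim _).mpr ⟨(μ - m) * 2, by push_cast; ring⟩
  rw [h3, sub_self] at h2
  rw [h.sum_smul_of_isWt hx, (mul_eq_zero.mp h2).resolve_left (sub_ne_zero.mpr h1), mul_zero,
    zero_smul]

/-- In a module generated by a vector `x` of weight `m`, the part of weight `m` is `k[C] x`, where
`C` is the Casimir element. -/
theorem exists_kappa'_smul [CharZero k] {x : M} {m : ℤ} (hx : IsWt k x m) (a : u k) :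
    ∃ p : Polynomial k, kappa' k l (2 * m) • a • x = Polynomial.aeval (casimir k l) p • x := by
  have ha := h.mem_span_F_pow_E_pow hx a
  generalize a • x = y at ha ⊢
  induction ha using Submodule.span_induction with
  | mem y hy =>
    obtain ⟨⟨i, j⟩, rfl⟩ := hy
    simp only
    by_cases hij : i = j
    · subst hij
      refine ⟨Polynomial.C (((qDiff k ^ 2)⁻¹) ^ i) * ∏ j ∈ Finset.range i,
        (Polynomial.X - Polynomial.C (casimirValue k (m + 2 * j))), ?_⟩
      rw [h.kappa'_smul_of_isWt, h.F_pow_smul_E_pow_smul hx, map_mul, Polynomial.aeval_C, mul_smul,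
        algebraMap_smul]
      have := (hx.E_pow_smul i).F_pow_smul i
      rwa [add_sub_cancel_right] at this
    · refine ⟨0, ?_⟩
      rw [map_zero, zero_smul]
      by_cases hi : l ≤ i
      · rw [pow_eq_zero_of_le hi (F_pow_eq_zero k h.one_lt h.odd h.prim), zero_smul, smul_zero]
      by_cases hj : l ≤ j
      · rw [pow_eq_zero_of_le hj (E_pow_eq_zero k h.one_lt h.odd h.prim), zero_smul, smul_zero,
          smul_zero]
      refine h.kappa'_smul_eq_zero ((hx.E_pow_smul j).F_pow_smul i) fun hd => ?_
      rw [show m + 2 * j - 2 * i - m = 2 * ((j : ℤ) - i) by ring, h.dvd_two_mul] at hd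
      have := Int.eq_zero_of_abs_lt_dvd hd (by rw [abs_lt]; omega)
      omega
  | zero => exact ⟨0, by simp⟩
  | add y z _ _ hy hz =>
    obtain ⟨p, hp⟩ := hy
    obtain ⟨p', hp'⟩ := hz
    exact ⟨p + p', by rw [smul_add, hp, hp', map_add, add_smul]⟩
  | smul c y _ hy =>
    obtain ⟨p, hp⟩ := hy
    exact ⟨Polynomial.C c * p, by
      rw [smul_comm, hp, map_mul, Polynomial.aeval_C, mul_smul, algebraMap_smul]⟩

end OddRoot

end Specialized

/-! ### The Verma modules `Δ̄_q(a)` -/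

section Specialized

variable {k : Type*} [Field k] [Algebra A k] {l : ℕ}

variable (k) in
/-- The highest weight vector of `Δ̄_q(μ)`. -/
def hwVector (μ : ℤ) : Delta k μ := Submodule.Quotient.mk 1

theorem smul_hwVector (μ : ℤ) (x : u k) : x • hwVector k μ = Submodule.Quotient.mk x := by
  rw [hwVector, ← Submodule.Quotient.mk_smul, smul_eq_mul, mul_one]

theorem exists_smul_hwVector {μ : ℤ} (y : Delta k μ) : ∃ x : u k, x • hwVector k μ = y := by
  obtain ⟨x, rfl⟩ := Submodule.Quotient.mk_surjective _ y
  exact ⟨x, smul_hwVector μ x⟩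

theorem E_smul_hwVector (μ : ℤ) : E k • hwVector k μ = 0 := by
  rw [smul_hwVector, Submodule.Quotient.mk_eq_zero]
  exact Submodule.subset_span (Or.inl rfl)

theorem isWt_hwVector (μ : ℤ) : IsWt k (hwVector k μ) μ := by
  have h : (K k - algebraMap k (u k) (q k ^ μ)) • hwVector k μ = 0 := by
    rw [smul_hwVector, Submodule.Quotient.mk_eq_zero]
    exact Submodule.subset_span (Or.inr rfl)
  rwa [sub_smul, sub_eq_zero, algebraMap_smul] at h

/-- The map from `Δ̄_q(μ)` to a module which sends the highest weight vector to a given vector. -/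
theorem exists_delta_hom {M : Type*} [AddCommGroup M] [Module (u k) M] [Module k M]
    [IsScalarTower k (u k) M] {μ : ℤ} {w : M} (hw : IsWt k w μ) (hE : E k • w = 0) :
    ∃ f : Delta k μ →ₗ[u k] M, f (hwVector k μ) = w := by
  refine ⟨Submodule.liftQ _ (LinearMap.toSpanSingleton (u k) M w) ?_, ?_⟩
  · rw [Submodule.span_le]
    rintro x (rfl | rfl)
    · exact hE
    · change (K k - algebraMap k (u k) (q k ^ μ)) • w = 0
      rw [sub_smul, algebraMap_smul, sub_eq_zero]
      exact hw
  · change LinearMap.toSpanSingleton (u k) M w 1 = w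
    exact one_smul _ w

variable (k) in
/-- `v` is a highest weight vector of weight `μ` and generates the module `D`. -/
structure IsHighest {D : Type*} [AddCommGroup D] [Module (u k) D] [Module k D] (v : D) (μ : ℤ) :
    Prop where
  isWt : IsWt k v μ
  E_smul : E k • v = 0
  exists_smul : ∀ y : D, ∃ x : u k, x • v = y

theorem isHighest_hwVector (μ : ℤ) : IsHighest k (hwVector k μ) μ :=
  ⟨isWt_hwVector μ, E_smul_hwVector μ, exists_smul_hwVector⟩

variable {D : Type*} [AddCommGroup D] [Module (u k) D] [Module k D] [IsScalarTower k (u k) D]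

namespace IsHighest

omit [IsScalarTower k (u k) D] in
theorem eq_top {v : D} {μ : ℤ} (hv : IsHighest k v μ) {N : Submodule (u k) D} (h : v ∈ N) :
    N = ⊤ := by
  refine eq_top_iff.mpr fun y _ => ?_
  obtain ⟨x, rfl⟩ := hv.exists_smul y
  exact N.smul_mem x h

theorem eq_top_of_smul_mem {v : D} {μ : ℤ} (hv : IsHighest k v μ) {N : Submodule (u k) D} {c : k}
    (hc : c ≠ 0) (h : c • v ∈ N) : N = ⊤ := by
  refine hv.eq_top ?_
  have h2 := N.smul_mem (algebraMap k (u k) c⁻¹) h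
  rwa [algebraMap_smul, smul_smul, inv_mul_cancel₀ hc, one_smul] at h2

end IsHighest

namespace OddRoot

variable (h : OddRoot k l) {v : D} {μ : ℤ}

include h

theorem casimir_smul_highest (hv : IsHighest k v μ) :
    casimir k l • v = casimirValue k μ • v := by
  rw [h.casimir_smul hv.isWt, hv.E_smul, smul_zero, smul_zero, zero_add]

theorem aeval_casimir_smul (hv : IsHighest k v μ) (p : Polynomial k) (y : D) :
    Polynomial.aeval (casimir k l) p • y = p.eval (casimirValue k μ) • y := by
  obtain ⟨x, rfl⟩ := hv.exists_smul y
  rw [h.aeval_smul_comm, ← smul_comm x]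
  congr 1
  induction p using Polynomial.induction_on' with
  | add p p' hp hp' => rw [map_add, add_smul, hp, hp', Polynomial.eval_add, add_smul]
  | monomial n c =>
    rw [Polynomial.aeval_monomial, Polynomial.eval_monomial, mul_smul, mul_smul, algebraMap_smul]
    congr 1
    induction n with
    | zero => simp
    | succ n ih =>
      rw [pow_succ, mul_smul, h.casimir_smul_highest hv, smul_comm, ih, smul_smul, pow_succ']

/-- The top weight part of a proper submodule of a highest weight module vanishes. -/
theorem kappa'_smul_of_mem [CharZero k] (hv : IsHighest k v μ) {N : Submodule (u k) D} (hN : N ≠ ⊤)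
    {y : D} (hy : y ∈ N) : kappa' k l (2 * μ) • y = 0 := by
  have h1 := N.smul_mem (kappa' k l (2 * μ)) hy
  obtain ⟨x, rfl⟩ := hv.exists_smul y
  obtain ⟨p, hp⟩ := h.exists_kappa'_smul hv.isWt x
  rw [hp, h.aeval_casimir_smul hv] at h1 ⊢
  by_cases hc : p.eval (casimirValue k μ) = 0
  · rw [hc, zero_smul]
  · exact absurd (hv.eq_top_of_smul_mem hc h1) hN

theorem highest_notMem_sSup [CharZero k] (hv : IsHighest k v μ) (hv0 : v ≠ 0) :
    v ∉ sSup {N : Submodule (u k) D | N ≠ ⊤} := by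
  intro h1
  refine hv0 ?_
  rw [← h.kappa'_smul_of_isWt hv.isWt]
  rw [sSup_eq_iSup'] at h1
  have key : ∀ y ∈ ⨆ N : {N : Submodule (u k) D | N ≠ ⊤}, (N : Submodule (u k) D),
      kappa' k l (2 * μ) • y = 0 := by
    intro y hy
    induction hy using Submodule.iSup_induction' with
    | mem N y hy => exact h.kappa'_smul_of_mem hv N.2 hy
    | zero => exact smul_zero _
    | add y z _ _ hy hz => rw [smul_add, hy, hz, add_zero]
  exact key v h1

/-- A submodule which contains `Fⁿ` of the highest weight vector of weight `a`, where
`n ≤ a < l`, is everything. -/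
theorem eq_top_of_F_pow_mem {a n : ℕ} (hv : IsHighest k v a) (ha : a < l) (hn : n ≤ a)
    {N : Submodule (u k) D} (hN : F k ^ n • v ∈ N) : N = ⊤ := by
  obtain ⟨c, hc, h1⟩ := h.exists_E_pow_smul_F_pow_smul ha hn hv.isWt hv.E_smul
  have h2 := N.smul_mem (E k ^ n) hN
  rw [h1] at h2
  exact hv.eq_top_of_smul_mem hc h2

theorem isNoetherian_of_isHighest (hv : IsHighest k v μ) : IsNoetherian (u k) D := by
  classical
  have hfin : Module.Finite k D := by
    refine ⟨⟨(Finset.range l).image fun i => F k ^ i • v, eq_top_iff.mpr ?_⟩⟩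
    intro y _
    obtain ⟨x, rfl⟩ := hv.exists_smul y
    refine Submodule.span_le.mpr ?_ (h.mem_span_F_pow_E_pow hv.isWt x)
    rintro _ ⟨⟨i, j⟩, rfl⟩
    cases j with
    | zero =>
      by_cases hi : i < l
      · refine Submodule.subset_span ?_
        simp only [Finset.coe_image, pow_zero, one_smul]
        exact ⟨i, by simpa using hi, rfl⟩
      · simp only [pow_eq_zero_of_le (not_lt.mp hi) (F_pow_eq_zero k h.one_lt h.odd h.prim),
          zero_smul]
        exact Submodule.zero_mem _
    | succ j =>
      simp only [pow_succ, mul_smul, hv.E_smul, smul_zero]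
      exact Submodule.zero_mem _
  exact isNoetherian_of_tower k inferInstance

theorem hwVector_ne_zero {a : ℕ} (ha : a < l) : hwVector k a ≠ 0 := by
  intro h0
  rw [hwVector, Submodule.Quotient.mk_eq_zero] at h0
  exact one_notMem_span k h.odd h.prim ha h0

/-! ### Modules generated by a weight vector in one generalized eigenspace of the Casimir element -/

/-- If a module is generated by a vector of weight `m`, and a power of `C - z` vanishes on this
generator, then the module is local: its part of weight `m` is a quotient of the local ring
`k[C] / (C - z)ᵈ`, and a submodule is proper if and only if its part of weight `m` lies in the
maximal ideal. -/
theorem eq_top_or_eq_top [CharZero k] {M : Type*} [AddCommGroup M] [Module (u k) M] [Module k M]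
    [IsScalarTower k (u k) M] {x : M} {m : ℤ} (hx : IsWt k x m) (hgen : ∀ y : M, ∃ a : u k, a • x = y)
    {z : k} {d : ℕ} (hz : Polynomial.aeval (casimir k l) ((Polynomial.X - Polynomial.C z) ^ d) • x = 0)
    {N N' : Submodule (u k) M} (hN : N ⊔ N' = ⊤) : N = ⊤ ∨ N' = ⊤ := by
  have hinv : ∀ p : Polynomial k, p.eval z ≠ 0 →
      ∃ p' : Polynomial k, Polynomial.aeval (casimir k l) p' •
        Polynomial.aeval (casimir k l) p • x = x := by
    intro p hp
    have hco : IsCoprime p ((Polynomial.X - Polynomial.C z) ^ d) := by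
      refine IsCoprime.pow_right (IsCoprime.symm ?_)
      refine (Polynomial.irreducible_X_sub_C z).coprime_iff_not_dvd.mpr ?_
      rwa [Polynomial.dvd_iff_isRoot]
    obtain ⟨p', g, hpg⟩ := hco
    refine ⟨p', ?_⟩
    have h1 := congrArg (fun g => Polynomial.aeval (casimir k l) g • x) hpg
    simpa only [map_add, map_mul, add_smul, mul_smul, hz, smul_zero, add_zero, map_one,
      one_smul] using h1
  have htop : ∀ N : Submodule (u k) M, x ∈ N → N = ⊤ := by
    intro N hN
    refine eq_top_iff.mpr fun y _ => ?_
    obtain ⟨a, rfl⟩ := hgen y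
    exact N.smul_mem a hN
  have hpart : ∀ N : Submodule (u k) M, N ≠ ⊤ → ∀ y ∈ N, ∃ p : Polynomial k, p.eval z = 0 ∧
      kappa' k l (2 * m) • y = Polynomial.aeval (casimir k l) p • x := by
    intro N hN y hy
    have hmem := N.smul_mem (kappa' k l (2 * m)) hy
    obtain ⟨a, rfl⟩ := hgen y
    obtain ⟨p, hp⟩ := h.exists_kappa'_smul hx a
    refine ⟨p, ?_, hp⟩
    by_contra hpz
    obtain ⟨p', hp'⟩ := hinv p hpz
    refine hN (htop N ?_)
    rw [← hp', ← hp]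
    exact N.smul_mem _ hmem
  by_contra! hcon
  obtain ⟨y, hy, y', hy', hyy'⟩ := Submodule.mem_sup.mp (hN ▸ Submodule.mem_top : x ∈ N ⊔ N')
  obtain ⟨p, hp, h1⟩ := hpart N hcon.1 y hy
  obtain ⟨p', hp', h1'⟩ := hpart N' hcon.2 y' hy'
  have h2 := h.kappa'_smul_of_isWt hx
  nth_rw 1 [← hyy'] at h2
  rw [smul_add, h1, h1', ← add_smul, ← map_add] at h2
  have h3 : Polynomial.aeval (casimir k l) (1 - (p + p')) • x = 0 := by
    rw [map_sub, sub_smul, h2, map_one, one_smul, sub_self]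
  obtain ⟨g, hg⟩ := hinv (1 - (p + p')) (by
    rw [Polynomial.eval_sub, Polynomial.eval_add, hp, hp', Polynomial.eval_one]; simp)
  rw [h3, smul_zero] at hg
  exact hcon.1 (htop N (hg ▸ N.zero_mem))

/-- A module generated by a vector `x` of weight `m` on which `C` acts by its value at the Steinberg
weight `-1` is a quotient of `Δ̄_q(-1)`: with `m + 2j = -1`, the vector `Eʲx` is a highest
weight vector, and `FʲEʲx` is a nonzero multiple of `x`. -/
theorem exists_delta_hom_surjective {M : Type*} [AddCommGroup M] [Module (u k) M] [Module k M]
    [IsScalarTower k (u k) M] {x : M} {m : ℤ} (hx : IsWt k x m) (hgen : ∀ y : M, ∃ a : u k, a • x = y)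
    (hC : casimir k l • x = casimirValue k (-1) • x) {j : ℕ} (hj : j < l)
    (hmj : (l : ℤ) ∣ m + 2 * j + 1) :
    ∃ f : Delta k ((l : ℤ) - 1) →ₗ[u k] M, Function.Surjective f := by
  have hl := h.l_pos
  have hne : ∀ i : ℕ, i < l → i ≠ j → casimirValue k (-1) - casimirValue k (m + 2 * i) ≠ 0 := by
    intro i hi hij h0
    have h2 : (l : ℤ) ∣ m + 2 * i + 1 := by
      rcases h.casimirValue_eq_iff.mp (sub_eq_zero.mp h0) with h1 | h1
      · rwa [← dvd_neg, show -(m + 2 * (i : ℤ) + 1) = -1 - (m + 2 * i) by ring]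
      · rwa [show m + 2 * (i : ℤ) + 1 = -1 + (m + 2 * i) + 2 by ring]
    have h3 := dvd_sub h2 hmj
    rw [show m + 2 * i + 1 - (m + 2 * j + 1) = 2 * ((i : ℤ) - j) by ring, h.dvd_two_mul] at h3
    have := Int.eq_zero_of_abs_lt_dvd h3 (by rw [abs_lt]; omega)
    omega
  have hFE : ∀ i : ℕ, F k • E k ^ (i + 1) • x =
      ((qDiff k ^ 2)⁻¹ * (casimirValue k (-1) - casimirValue k (m + 2 * i))) • E k ^ i • x := by
    intro i
    rw [pow_succ', mul_smul, h.F_smul_E_smul (hx.E_pow_smul i), h.casimir_smul_comm, hC,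
      smul_comm (E k ^ i), ← sub_smul, smul_smul]
  have hd : (qDiff k ^ 2)⁻¹ ≠ 0 := inv_ne_zero (pow_ne_zero 2 h.diff_ne_zero)
  -- Downwards from `Eˡx = 0`, as `F Eⁱ⁺¹x` is a nonzero multiple of `Eⁱx` for `j < i < l`.
  have hE : ∀ n i : ℕ, i + n = l → j < i → E k ^ i • x = 0 := by
    intro n
    induction n with
    | zero =>
      intro i hi _
      rw [show i = l by omega, E_pow_eq_zero k h.one_lt h.odd h.prim, zero_smul]
    | succ n ih =>
      intro i hi hji
      have h1 := hFE i
      rw [ih (i + 1) (by omega) (by omega), smul_zero, eq_comm] at h1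
      exact (smul_eq_zero.mp h1).resolve_left (mul_ne_zero hd (hne i (by omega) (by omega)))
  have hwt : IsWt k (E k ^ j • x) ((l : ℤ) - 1) := by
    refine (hx.E_pow_smul j).of_dvd h ?_
    rw [show m + 2 * (j : ℤ) - (l - 1) = m + 2 * j + 1 - l by ring]
    exact dvd_sub hmj (dvd_refl (l : ℤ))
  obtain ⟨f, hf⟩ := exists_delta_hom hwt (by
    rw [← mul_smul, ← pow_succ']; exact hE (l - (j + 1)) (j + 1) (by omega) (by omega))
  refine ⟨f, ?_⟩
  have hF : ∀ i ≤ j, ∃ c : k, c ≠ 0 ∧ F k ^ i • E k ^ i • x = c • x := by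
    intro i
    induction i with
    | zero => intro _; exact ⟨1, one_ne_zero, by simp⟩
    | succ i ih =>
      intro hi
      obtain ⟨c, hc, h1⟩ := ih (by omega)
      refine ⟨(qDiff k ^ 2)⁻¹ * (casimirValue k (-1) - casimirValue k (m + 2 * i)) * c,
        mul_ne_zero (mul_ne_zero hd (hne i (by omega) (by omega))) hc, ?_⟩
      rw [pow_succ (F k), mul_smul, hFE, smul_comm, h1, smul_smul]
  obtain ⟨c, hc, h1⟩ := hF j le_rfl
  intro y
  obtain ⟨a, rfl⟩ := hgen y
  refine ⟨(a * (algebraMap k (u k) c⁻¹ * F k ^ j)) • hwVector k _, ?_⟩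
  rw [map_smul, hf, mul_smul, mul_smul, h1, algebraMap_smul, smul_smul, inv_mul_cancel₀ hc,
    one_smul]

end OddRoot
end Specialized

/-! ### Decomposition under a central element -/

section Central

variable {k R P : Type*} [Field k] [Ring R] [Algebra k R] [AddCommGroup P] [Module R P]

/-- The kernel of a central element on a module, as a submodule. -/
def centralKer (P : Type*) [AddCommGroup P] [Module R P] (z : R) (hz : ∀ x, x * z = z * x) :
    Submodule R P where
  carrier := {y | z • y = 0}
  zero_mem' := smul_zero z
  add_mem' {y y'} hy hy' := by
    change z • (y + y') = 0
    rw [smul_add, show z • y = 0 from hy, show z • y' = 0 from hy', add_zero]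
  smul_mem' x y hy := by
    change z • x • y = 0
    rw [← mul_smul, ← hz, mul_smul, show z • y = 0 from hy, smul_zero]

theorem isInternal_centralKer {ι : Type*} [DecidableEq ι] (S : Finset ι) (p : ι → Polynomial k)
    (hp : (S : Set ι).Pairwise (Function.onFun IsCoprime p)) (c : R)
    (hc : ∀ g : Polynomial k, ∀ x, x * Polynomial.aeval c g = Polynomial.aeval c g * x)
    (hP : ∀ y : P, Polynomial.aeval c (∏ i ∈ S, p i) • y = 0) :
    DirectSum.IsInternal fun i : S => centralKer P (Polynomial.aeval c (p i)) (hc (p i)) := by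
  let _ : Module (Polynomial k) P := Module.compHom P (Polynomial.aeval c).toRingHom
  have h := Submodule.torsionBy_isInternal (R := Polynomial k) (M := P) (S := S) (q := p) hp
    fun y => hP y
  exact h

theorem exists_projection {ι : Type*} [DecidableEq ι] {N : ι → Submodule R P}
    (h : DirectSum.IsInternal N) (i : ι) :
    ∃ π : P →ₗ[R] N i, ∀ y : N i, π y = y := by
  let e := LinearEquiv.ofBijective (DirectSum.coeLinearMap N) h
  refine ⟨(DirectSum.component R ι (fun i => N i) i).comp e.symm.toLinearMap, fun y => ?_⟩
  have h1 : e (DirectSum.lof R ι (fun i => N i) i y) = y := DirectSum.coeLinearMap_lof N i y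
  rw [LinearMap.comp_apply, LinearEquiv.coe_coe, ← h1, e.symm_apply_apply,
    DirectSum.component.lof_self]

/-- Two modules with surjections in both directions are isomorphic, if one is Noetherian. -/
theorem nonempty_linearEquiv_of_surjective {D : Type*} [AddCommGroup D] [Module R D]
    [IsNoetherian R D] {f : D →ₗ[R] P} {ψ : P →ₗ[R] D} (hf : Function.Surjective f)
    (hψ : Function.Surjective ψ) : Nonempty (P ≃ₗ[R] D) := by
  have h : Function.Injective (ψ.comp f) :=
    IsNoetherian.injective_of_surjective_endomorphism _ (hψ.comp hf)
  exact ⟨(LinearEquiv.ofBijective f ⟨Function.Injective.of_comp h, hf⟩).symm⟩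

end Central

section Specialized

variable {k : Type*} [Field k] [Algebra A k] {l : ℕ}

theorem IsWt.map {M M' : Type*} [AddCommGroup M] [Module (u k) M] [Module k M]
    [IsScalarTower k (u k) M] [AddCommGroup M'] [Module (u k) M'] [Module k M']
    [IsScalarTower k (u k) M'] {x : M} {μ : ℤ} (hx : IsWt k x μ) (f : M →ₗ[u k] M') :
    IsWt k (f x) μ := by
  unfold IsWt at *
  rw [← map_smul, hx, ← algebraMap_smul (u k), map_smul, algebraMap_smul]

variable (k) in
/-- The simple module of highest weight `μ`, as a function of `c = q ^ μ`. -/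
abbrev simpleOfScalar (c : k) : Type _ :=
  (u k ⧸ Submodule.span (u k) {E k, K k - algebraMap k (u k) c}) ⧸
    sSup {N : Submodule (u k) (u k ⧸ Submodule.span (u k) {E k, K k - algebraMap k (u k) c}) |
      N ≠ ⊤}

/-- The module `L̄_q(μ)` depends on `q ^ μ` only. -/
theorem isProjectiveCover_L_congr {P : Type*} [AddCommGroup P] [Module (u k) P] {μ ν : ℤ}
    (hμν : q k ^ μ = q k ^ ν) (hP : IsProjectiveCover (u k) P (L k μ)) :
    IsProjectiveCover (u k) P (L k ν) := by
  change IsProjectiveCover (u k) P (simpleOfScalar k (q k ^ μ)) at hP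
  change IsProjectiveCover (u k) P (simpleOfScalar k (q k ^ ν))
  rwa [← hμν]

namespace OddRoot

variable (h : OddRoot k l) {M : Type*} [AddCommGroup M] [Module (u k) M] [Module k M]
  [IsScalarTower k (u k) M]

include h

/-- `∏ (C - z(m + 2i)) = 0` on a module generated by a vector of weight `m`, because
`FˡEˡ = 0`. -/
theorem aeval_casimir_prod_smul {x : M} {m : ℤ} (hx : IsWt k x m)
    (hgen : ∀ y : M, ∃ a : u k, a • x = y) (y : M) :
    Polynomial.aeval (casimir k l) (∏ i ∈ Finset.range l,
      (Polynomial.X - Polynomial.C (casimirValue k (m + 2 * i)))) • y = 0 := by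
  obtain ⟨a, rfl⟩ := hgen y
  rw [h.aeval_smul_comm]
  have h1 := h.F_pow_smul_E_pow_smul hx l
  rw [E_pow_eq_zero k h.one_lt h.odd h.prim, zero_smul, smul_zero, eq_comm] at h1
  rw [(smul_eq_zero.mp h1).resolve_left
    (pow_ne_zero _ (inv_ne_zero (pow_ne_zero 2 h.diff_ne_zero))), smul_zero]

omit [Module k M] [IsScalarTower k (u k) M] in
/-- Let `N r` be the eigenspaces in a module generated by a vector `x` of weight `m`, where `r`
corresponds to the block with Casimir eigenvalue `z r`. A highest weight module `D` in the block of
`r` receives a surjection from `N r`, if there is a map `Φ` to `D` which sends `x` to a vector that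
generates `D`. -/
theorem exists_surjective_of_block {I : Finset ℤ} {N : I → Submodule (u k) M}
    (hint : DirectSum.IsInternal N) {p : ℤ → Polynomial k}
    (hN : ∀ r, ∀ y ∈ N r, Polynomial.aeval (casimir k l) (p r) • y = 0)
    {D : Type*} [AddCommGroup D] [Module (u k) D] [Module k D] [IsScalarTower k (u k) D] {v : D}
    {μ : ℤ} (hv : IsHighest k v μ) (r : I) (hp : ∀ s ≠ r, (p s).eval (casimirValue k μ) ≠ 0)
    (Φ : M →ₗ[u k] D) (hΦ : LinearMap.range Φ = ⊤) :
    ∃ ψ : N r →ₗ[u k] D, Function.Surjective ψ := by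
  have hother : ∀ s : I, s ≠ r → Submodule.map Φ (N s) = ⊥ := by
    intro s hs
    rw [eq_bot_iff]
    rintro _ ⟨y, hy, rfl⟩
    have h1 := congrArg Φ (hN s y hy)
    rw [map_smul, map_zero, h.aeval_casimir_smul hv] at h1
    exact (smul_eq_zero.mp h1).resolve_left fun h2 => hp s hs h2
  have hr : Submodule.map Φ (N r) = ⊤ := by
    rw [← hΦ, ← Submodule.map_top, ← hint.submodule_iSup_eq_top, Submodule.map_iSup]
    refine le_antisymm (le_iSup (fun s => Submodule.map Φ (N s)) r) (iSup_le fun s => ?_)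
    by_cases hs : s = r
    · rw [hs]
    · rw [hother s hs]; exact bot_le
  refine ⟨Φ.comp (N r).subtype, LinearMap.range_eq_top.mp ?_⟩
  rw [LinearMap.range_comp, Submodule.range_subtype, hr]

omit h in
theorem casimir_smul_of_dvd {x : M} {z : k} {p : Polynomial k}
    (hp : p ∣ Polynomial.X - Polynomial.C z) (hx : Polynomial.aeval (casimir k l) p • x = 0) :
    casimir k l • x = z • x := by
  obtain ⟨g, hg⟩ := hp
  have h2 := congrArg (fun g => Polynomial.aeval (casimir k l) g • x) hg
  simp only [mul_comm p, map_mul, mul_smul, hx, smul_zero, map_sub, Polynomial.aeval_X,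
    Polynomial.aeval_C, sub_smul, algebraMap_smul] at h2
  exact sub_eq_zero.mp h2

omit [Module k M] [IsScalarTower k (u k) M] in
/-- The left ideal `u_q κ'_{2m}`, given as a module `M` with generator `x` and inclusion `ι`, has a
surjection to a highest weight module which has a nonzero vector of weight `m` outside the
maximal submodule. -/
theorem exists_hom_range_eq_top [CharZero k] {x : M} {m : ℤ} (ι : M →ₗ[u k] u k)
    (hιx : ι x = kappa' k l (2 * m)) {D : Type*} [AddCommGroup D] [Module (u k) D] [Module k D]
    [IsScalarTower k (u k) D] {v : D} {a j : ℕ} (hv : IsHighest k v a) (ha : a < l) (hj : j ≤ a)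
    (hajm : (l : ℤ) ∣ a - 2 * j - m) : ∃ Φ : M →ₗ[u k] D, LinearMap.range Φ = ⊤ := by
  have hw : IsWt k (F k ^ j • v) m := (hv.isWt.F_pow_smul j).of_dvd h hajm
  refine ⟨(LinearMap.toSpanSingleton (u k) _ (F k ^ j • v)).comp ι,
    h.eq_top_of_F_pow_mem hv ha hj ⟨x, ?_⟩⟩
  rw [LinearMap.comp_apply, hιx]
  exact h.kappa'_smul_of_isWt hw

/-- The summands of `u_q κ'_{2m}` are its generalized eigenspaces for the Casimir element. This left
ideal is given here as a module `M` with generator `x` and inclusion `ι`. The set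
`I` indexes the eigenvalues, `σ i` is the index of the eigenvalue at the weight `m + 2i`, and
`L̄_q(2r - m)` is the simple module in the block of `r` which has a vector of weight `m`. -/
theorem exists_decomposition [CharZero k] {x : M} {m : ℤ} (hx : IsWt k x m) (ι : M →ₗ[u k] u k)
    (hιx : ι x = kappa' k l (2 * m)) (hι : ∀ y, ι y • x = y) (I : Finset ℤ) (σ : ℕ → ℤ)
    (hσ : ∀ i < l, σ i ∈ I ∧ casimirValue k (m + 2 * i) = casimirValue k (2 * σ i - m))
    (hinj : ∀ r ∈ I, ∀ s ∈ I, casimirValue k (2 * r - m) = casimirValue k (2 * s - m) → r = s)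
    (hwt : ∀ r ∈ I, ∃ a j : ℕ, a < l ∧ j ≤ a ∧ (l : ℤ) ∣ a - (2 * r - m) ∧
      (l : ℤ) ∣ a - 2 * j - m) :
    ∃ N : I → Submodule (u k) M, DirectSum.IsInternal N ∧
      (∀ r, IsProjectiveCover (u k) (N r) (L k (2 * r - m))) ∧
      ∀ r : I, (l : ℤ) ∣ 2 * r - m + 1 → Nonempty (N r ≃ₗ[u k] St k l) := by
  have hgx : ∀ y : M, ∃ a : u k, a • x = y := fun y => ⟨ι y, hι y⟩
  set p : ℤ → Polynomial k := fun r => ∏ i ∈ Finset.range l with σ i = r,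
    (Polynomial.X - Polynomial.C (casimirValue k (m + 2 * i)))
  have hpow : ∀ r, p r = (Polynomial.X - Polynomial.C (casimirValue k (2 * r - m))) ^
      (Finset.card {i ∈ Finset.range l | σ i = r}) := by
    intro r
    rw [← Finset.prod_const]
    refine Finset.prod_congr rfl fun i hi => ?_
    obtain ⟨hi1, hi2⟩ := Finset.mem_filter.mp hi
    rw [(hσ i (Finset.mem_range.mp hi1)).2, hi2]
  have hprod : ∏ r ∈ I, p r = ∏ i ∈ Finset.range l,
      (Polynomial.X - Polynomial.C (casimirValue k (m + 2 * i))) :=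
    Finset.prod_fiberwise_of_maps_to (fun i hi => (hσ i (Finset.mem_range.mp hi)).1) _
  have hcop : (I : Set ℤ).Pairwise (Function.onFun IsCoprime p) := by
    intro r hr s hs hrs
    change IsCoprime (p r) (p s)
    rw [hpow, hpow]
    exact (Polynomial.isCoprime_X_sub_C_of_isUnit_sub (IsUnit.mk0 _ (sub_ne_zero.mpr fun h1 =>
      hrs (hinj r hr s hs h1)))).pow
  have hint := isInternal_centralKer (P := M) I p hcop (casimir k l)
    h.aeval_casimir_comm (fun y => by rw [hprod]; exact h.aeval_casimir_prod_smul hx hgx y)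
  set N : I → Submodule (u k) M := fun r =>
    centralKer _ (Polynomial.aeval (casimir k l) (p r)) (h.aeval_casimir_comm (p r))
  have hNmem : ∀ (r : I) (y : M), y ∈ N r →
      Polynomial.aeval (casimir k l) (p r) • y = 0 := fun r y hy => hy
  -- A generator of each summand.
  have hgen : ∀ r : I, ∃ (π : M →ₗ[u k] N r), (∀ y : N r, π y = y) ∧
      IsWt k (π x) m ∧ ∀ y : N r, ∃ a : u k, a • π x = y := by
    intro r
    obtain ⟨π, hπ⟩ := exists_projection hint r
    refine ⟨π, hπ, hx.map π, fun y => ?_⟩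
    obtain ⟨a, ha⟩ := hgx y
    exact ⟨a, by rw [← map_smul, ha, hπ]⟩
  -- A map onto the Verma module with simple head `L̄_q(2r - m)`.
  have hsurj : ∀ r : I, ∀ a j : ℕ, a < l → j ≤ a → (l : ℤ) ∣ a - (2 * r - m) →
      (l : ℤ) ∣ a - 2 * j - m → ∃ ψ : N r →ₗ[u k] Delta k a, Function.Surjective ψ := by
    intro r a j ha hj har hajm
    obtain ⟨Φ, hΦ⟩ := h.exists_hom_range_eq_top ι hιx (isHighest_hwVector (k := k) (a : ℤ)) ha hj hajm
    have hval : casimirValue k a = casimirValue k (2 * r - m) :=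
      h.casimirValue_eq_iff.mpr (Or.inl har)
    refine h.exists_surjective_of_block hint hNmem (isHighest_hwVector (k := k) (a : ℤ)) r
      (fun s hs => ?_) Φ hΦ
    rw [hpow, hval, Polynomial.eval_pow, Polynomial.eval_sub, Polynomial.eval_X, Polynomial.eval_C]
    exact pow_ne_zero _ (sub_ne_zero.mpr fun h2 =>
      hs (Subtype.ext (hinj r r.2 s s.2 h2).symm))
  refine ⟨N, hint, fun r => ?_, fun r hst => ?_⟩
  · obtain ⟨a, j, ha, hj, har, hajm⟩ := hwt r r.2
    obtain ⟨π, hπ, hπwt, hπgen⟩ := hgen r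
    obtain ⟨ψ, hψ⟩ := hsurj r a j ha hj har hajm
    have hq : q k ^ (a : ℤ) = q k ^ (2 * r - m : ℤ) := by
      rw [← div_eq_one_iff_eq (zpow_ne_zero _ (q_ne_zero k)), ← zpow_sub₀ (q_ne_zero k)]
      exact (zpow_eq_one_iff k h.prim _).mpr har
    refine isProjectiveCover_L_congr hq ⟨Module.Projective.of_split (ι.comp (N r).subtype)
        (π.comp (LinearMap.toSpanSingleton (u k) _ x)) (LinearMap.ext fun y => by
          change π (ι y • x) = y
          rw [hι, hπ]),
      (Submodule.mkQ _).comp ψ, (Submodule.mkQ_surjective _).comp hψ, fun N' hN' => ?_⟩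
    have hzero : Polynomial.aeval (casimir k l)
        ((Polynomial.X - Polynomial.C (casimirValue k (2 * r - m))) ^
          (Finset.card {i ∈ Finset.range l | σ i = r})) • π x = 0 := by
      rw [← hpow]
      exact Subtype.ext (hNmem r _ (π x).2)
    refine (h.eq_top_or_eq_top hπwt hπgen hzero hN').resolve_right fun hker => ?_
    obtain ⟨y, hy⟩ := hψ (hwVector k a)
    have h1 : y ∈ LinearMap.ker ((Submodule.mkQ (sSup {N : Submodule (u k) (Delta k a) |
      N ≠ ⊤})).comp ψ) := hker ▸ Submodule.mem_top
    rw [LinearMap.mem_ker, LinearMap.comp_apply, hy, Submodule.mkQ_apply,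
      Submodule.Quotient.mk_eq_zero] at h1
    exact h.highest_notMem_sSup (isHighest_hwVector (k := k) (a : ℤ)) (h.hwVector_ne_zero ha) h1
  · obtain ⟨a, j, ha, hj, har, hajm⟩ := hwt r r.2
    obtain ⟨π, hπ, hπwt, hπgen⟩ := hgen r
    have hs := hsurj r a j ha hj har hajm
    have hl := h.l_pos
    have hal : (a : ℤ) = l - 1 := by
      have h1 := dvd_add har hst
      rw [show (a : ℤ) - (2 * r - m) + (2 * r - m + 1) = a + 1 by ring] at h1
      have := Int.le_of_dvd (by omega) h1
      omega
    have hval : casimirValue k (2 * r - m) = casimirValue k (-1) :=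
      h.casimirValue_eq_iff.mpr (Or.inl (by rwa [sub_neg_eq_add]))
    have hcard : Finset.card {i ∈ Finset.range l | σ i = r} ≤ 1 := by
      have key : ∀ i ∈ ({i ∈ Finset.range l | σ i = r} : Finset ℕ),
          i < l ∧ (l : ℤ) ∣ m + 2 * i + 1 := by
        intro i hi
        obtain ⟨hi1, hi2⟩ := Finset.mem_filter.mp hi
        have hi1 := Finset.mem_range.mp hi1
        have h1 := (hσ i hi1).2
        rw [hi2, hval] at h1
        refine ⟨hi1, ?_⟩
        rcases h.casimirValue_eq_iff.mp h1 with h2 | h2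
        · rwa [sub_neg_eq_add] at h2
        · rwa [show m + 2 * (i : ℤ) + -1 + 2 = m + 2 * i + 1 by ring] at h2
      refine Finset.card_le_one.mpr fun i hi i' hi' => ?_
      obtain ⟨h1, h2⟩ := key i hi
      obtain ⟨h1', h2'⟩ := key i' hi'
      have h3 := dvd_sub h2 h2'
      rw [show m + 2 * i + 1 - (m + 2 * i' + 1) = 2 * ((i : ℤ) - i') by ring, h.dvd_two_mul] at h3
      have := Int.eq_zero_of_abs_lt_dvd h3 (by rw [abs_lt]; omega)
      omega
    have hC : casimir k l • π x = casimirValue k (-1) • π x := by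
      have h1 : Polynomial.aeval (casimir k l) (p r) • π x = 0 :=
        Subtype.ext (hNmem r _ (π x).2)
      refine casimir_smul_of_dvd (k := k) (l := l) (M := N r) (x := π x) (p := p r) ?_ h1
      rw [hpow, hval]
      nth_rw 2 [← pow_one (Polynomial.X - Polynomial.C (casimirValue k (-1)))]
      exact pow_dvd_pow _ hcard
    obtain ⟨f, hf⟩ := h.exists_delta_hom_surjective hπwt hπgen hC (j := j) (by omega) (by
      have h1 := dvd_sub (dvd_refl (l : ℤ)) hajm
      rwa [hal, show (l : ℤ) - (l - 1 - 2 * j - m) = m + 2 * j + 1 by ring] at h1)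
    rw [hal] at hs
    obtain ⟨ψ, hψ⟩ := hs
    have := h.isNoetherian_of_isHighest (isHighest_hwVector (k := k) ((l : ℤ) - 1))
    exact nonempty_linearEquiv_of_surjective hf hψ

end OddRoot
end Specialized

/-! ### The index sets -/

/-- The integers in `[0, m/2[ ∪ [m, (l+m-1)/2]`, for `0 ≤ m < l`. -/
def indexSet (l : ℕ) (m : ℤ) : Finset ℤ :=
  {r ∈ Finset.Ico (0 : ℤ) l | 2 * r < m ∨ (m ≤ r ∧ 2 * r ≤ l + m - 1)}

/-- The `r` for which `L̄_q(2r - m)` lies in the block of the weight `m + 2i`. -/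
def blockIndex (l : ℕ) (m : ℤ) (i : ℕ) : ℤ :=
  if 2 * (m + i) ≤ l + m - 1 then m + i
  else if l ≤ m + i ∧ 2 * (m + i - l) < m then m + i - l
  else l - 1 - i

theorem mem_indexSet {l : ℕ} {m r : ℤ} (hm : 0 ≤ m) (hml : m < l) :
    r ∈ indexSet l m ↔ 0 ≤ r ∧ (2 * r < m ∨ (m ≤ r ∧ 2 * r ≤ l + m - 1)) := by
  simp only [indexSet, Finset.mem_filter, Finset.mem_Ico]
  omega

/-- The weight `2r - m` is congruent to some `a` with `0 ≤ a < l`, and `m` is congruent to one of the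
weights `a, a - 2, …, -a` of the simple module of highest weight `a`. -/
theorem exists_weight_of_mem {l : ℕ} {m : ℤ} (hm : 0 ≤ m) (hml : m < l) {r : ℤ}
    (hr : r ∈ indexSet l m) :
    ∃ a j : ℕ, a < l ∧ j ≤ a ∧ (l : ℤ) ∣ a - (2 * r - m) ∧ (l : ℤ) ∣ a - 2 * j - m := by
  rw [mem_indexSet hm hml] at hr
  by_cases h1 : 2 * r < m
  · refine ⟨(l - m + 2 * r).toNat, (l - m + r).toNat, by omega, by omega, ?_, ?_⟩
    · rw [Int.toNat_of_nonneg (by omega)]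
      exact ⟨1, by ring⟩
    · rw [Int.toNat_of_nonneg (by omega), Int.toNat_of_nonneg (by omega)]
      exact ⟨-1, by ring⟩
  · refine ⟨(2 * r - m).toNat, (r - m).toNat, by omega, by omega, ?_, ?_⟩
    · rw [Int.toNat_of_nonneg (by omega), sub_self]
      exact dvd_zero _
    · rw [Int.toNat_of_nonneg (by omega), Int.toNat_of_nonneg (by omega)]
      exact ⟨0, by ring⟩

section Specialized

variable {k : Type*} [Field k] [Algebra A k] {l : ℕ}

namespace OddRoot

variable (h : OddRoot k l)

include h

theorem blockIndex_mem {m : ℤ} (hm : 0 ≤ m) (hml : m < l) {i : ℕ} (hi : i < l) :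
    blockIndex l m i ∈ indexSet l m ∧
      casimirValue k (m + 2 * i) = casimirValue k (2 * blockIndex l m i - m) := by
  obtain ⟨c, hc⟩ := h.odd
  constructor
  · rw [mem_indexSet hm hml, blockIndex]
    split_ifs <;> omega
  · rw [h.casimirValue_eq_iff, blockIndex]
    split_ifs
    · exact Or.inl ⟨0, by ring⟩
    · exact Or.inl ⟨2, by ring⟩
    · exact Or.inr ⟨2, by ring⟩

theorem casimirValue_injOn {m : ℤ} (hm : 0 ≤ m) (hml : m < l) {r s : ℤ} (hr : r ∈ indexSet l m)
    (hs : s ∈ indexSet l m) (hrs : casimirValue k (2 * r - m) = casimirValue k (2 * s - m)) :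
    r = s := by
  rw [mem_indexSet hm hml] at hr hs
  rcases h.casimirValue_eq_iff.mp hrs with h1 | h1
  · rw [show 2 * r - m - (2 * s - m) = 2 * (r - s) by ring, h.dvd_two_mul] at h1
    have := Int.eq_zero_of_abs_lt_dvd h1 (by rw [abs_lt]; omega)
    omega
  · rw [show 2 * r - m + (2 * s - m) + 2 = 2 * (r + s + 1 - m) by ring, h.dvd_two_mul] at h1
    obtain ⟨c, hc⟩ := h1
    have hc0 : -1 < c := by
      by_contra hcon
      have h2 : (l : ℤ) * c ≤ l * -1 := mul_le_mul_of_nonneg_left (by omega) (by omega)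
      omega
    have hc2 : c < 2 := by
      by_contra hcon
      have h2 : (l : ℤ) * 2 ≤ l * c := mul_le_mul_of_nonneg_left (by omega) (by omega)
      omega
    obtain rfl | rfl : c = 0 ∨ c = 1 := by omega
    all_goals omega

/-- The decomposition of `u_q κ'_{2m}`, transported to an isomorphic module `M`, with the weights
of the summands given modulo `l` only. -/
theorem decomposesAs_of_linearEquiv [CharZero k] {m : ℤ} (hm : 0 ≤ m) (hml : m < l) {M : Type*}
    [AddCommGroup M] [Module (u k) M] (e : M ≃ₗ[u k] uKappa' k l (2 * m)) {I : Set ℤ}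
    {wt : ℤ → ℤ} {isSt : ℤ → Prop} (hI : I = indexSet l m)
    (hwt : ∀ r ∈ I, (l : ℤ) ∣ wt r - (2 * r - m)) (hex : ∃ r ∈ I, isSt r)
    (hst : ∀ r ∈ I, isSt r → (l : ℤ) ∣ 2 * r - m + 1) : DecomposesAs k l M I wt isSt := by
  subst hI
  let _ : Module k M := Module.compHom M (algebraMap k (u k))
  have : IsScalarTower k (u k) M := ⟨fun c x y => by
    change (c • x) • y = algebraMap k (u k) c • x • y
    rw [Algebra.smul_def, mul_smul]⟩
  set κ : uKappa' k l (2 * m) := ⟨kappa' k l (2 * m), Submodule.mem_span_singleton_self _⟩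
  have hκ : IsWt k (kappa' k l (2 * m)) m := h.isWt_kappa' m
  have hx : IsWt k (e.symm κ) m := by
    have h1 : K k • κ = algebraMap k (u k) (q k ^ m) • κ := Subtype.ext (by
      change K k • kappa' k l (2 * m) = algebraMap k (u k) (q k ^ m) • kappa' k l (2 * m)
      rw [algebraMap_smul]
      exact hκ)
    have h2 := congrArg e.symm h1
    rw [map_smul, map_smul, algebraMap_smul] at h2
    exact h2
  obtain ⟨N, hN, hcov, hSt⟩ := h.exists_decomposition hx
    ((uKappa' k l (2 * m)).subtype.comp e.toLinearMap) (by simp [κ]) (fun y => by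
      apply e.injective
      rw [map_smul, LinearEquiv.apply_symm_apply]
      apply Subtype.ext
      change (e y : u k) * kappa' k l (2 * m) = e y
      obtain ⟨a, ha⟩ := Submodule.mem_span_singleton.mp (e y).2
      rw [← ha, smul_eq_mul, mul_assoc]
      congr 1
      exact h.kappa'_smul_of_isWt hκ)
    (indexSet l m) (blockIndex l m) (fun i hi => h.blockIndex_mem hm hml hi)
    (fun r hr s hs => h.casimirValue_injOn hm hml hr hs)
    (fun r hr => exists_weight_of_mem hm hml hr)
  refine ⟨N, hN, fun r => ?_, ?_, fun r hr => hSt r (hst r r.2 hr)⟩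
  · refine isProjectiveCover_L_congr ?_ (hcov r)
    rw [eq_comm, ← div_eq_one_iff_eq (zpow_ne_zero _ (q_ne_zero k)), ← zpow_sub₀ (q_ne_zero k)]
    exact (zpow_eq_one_iff k h.prim _).mpr (hwt r r.2)
  · obtain ⟨r, hr, hr'⟩ := hex
    exact ⟨⟨r, hr⟩, hr'⟩

/-! ### The twist -/

omit h in
theorem tilde_E : tilde k (E k) = -E k := Subtype.ext (tildeUq_uqGen_E k)

omit h in
theorem tilde_F : tilde k (F k) = F k := Subtype.ext (tildeUq_uqGen_F k)

omit h in
theorem tilde_K : tilde k (K k) = -K k := Subtype.ext (tildeUq_uqGen_K k)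

omit h in
theorem tilde_tilde (x : u k) : tilde k (tilde k x) = x := by
  induction x using u_induction with
  | hE => rw [tilde_E, map_neg, tilde_E, neg_neg]
  | hF => rw [tilde_F, tilde_F]
  | hK => rw [tilde_K, map_neg, tilde_K, neg_neg]
  | halg c => rw [AlgHom.commutes, AlgHom.commutes]
  | hadd x y hx hy => rw [map_add, map_add, hx, hy]
  | hmul x y hx hy => rw [map_mul, map_mul, hx, hy]

theorem sqrtq_pow : sqrtq k l ^ l = -1 := by
  obtain ⟨c, hc⟩ := h.odd
  rw [sqrtq, h.odd.neg_pow, ← zpow_natCast, ← zpow_mul, mul_comm, zpow_mul, zpow_natCast,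
    h.prim.pow_eq_one, one_zpow]

theorem sqrtq_ne_zero : sqrtq k l ≠ 0 := by
  intro h0
  have h1 := h.sqrtq_pow
  rw [h0, zero_pow h.l_pos.ne', eq_comm, neg_eq_zero] at h1
  exact one_ne_zero h1

/-- As `(q^{1/2})ˡ = -1`, the twist sends `κ'ₙ` to `κ'_{n+cl}` for odd `c`. -/
theorem tilde_kappa' {n n' c : ℤ} (hc : Odd c) (hn : n' = n + c * l) :
    tilde k (kappa' k l n) = kappa' k l n' := by
  subst hn
  unfold kappa'
  rw [map_smul, map_sum]
  congr 1
  refine Finset.sum_congr rfl fun i _ => ?_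
  have hs := h.sqrtq_ne_zero
  have h1 : sqrtq k l ^ (-(c * l)) = -1 := by
    rw [mul_comm, ← mul_neg, zpow_mul, zpow_natCast, h.sqrtq_pow, hc.neg.neg_one_zpow]
  rw [map_smul, map_pow, tilde_K, ← neg_one_smul k (K k), smul_pow, smul_smul,
    show -((n + c * l) * (i : ℤ)) = -(n * i) + -(c * l) * i by ring, zpow_add₀ hs,
    zpow_mul (sqrtq k l) (-(c * l)), h1, zpow_natCast]

/-- The twist of `u_q κ'ₙ` is `u_q κ'_{n+cl}` for odd `c`. -/
theorem exists_twist_equiv {n n' c : ℤ} (hc : Odd c) (hn : n' = n + c * l) :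
    Nonempty (Twist (uKappa' k l n) ≃ₗ[u k] uKappa' k l n') := by
  have h1 : ∀ y ∈ uKappa' k l n, tilde k y ∈ uKappa' k l n' := by
    intro y hy
    obtain ⟨a, rfl⟩ := Submodule.mem_span_singleton.mp hy
    rw [smul_eq_mul, map_mul, h.tilde_kappa' hc hn]
    exact Submodule.smul_mem _ _ (Submodule.mem_span_singleton_self _)
  have h2 : ∀ y ∈ uKappa' k l n', tilde k y ∈ uKappa' k l n := by
    intro y hy
    obtain ⟨a, rfl⟩ := Submodule.mem_span_singleton.mp hy
    rw [smul_eq_mul, map_mul, h.tilde_kappa' (n := n') (n' := n) hc.neg (by rw [hn]; ring)]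
    exact Submodule.smul_mem _ _ (Submodule.mem_span_singleton_self _)
  let f (y : uKappa' k l n) : uKappa' k l n' := ⟨tilde k y, h1 y y.2⟩
  let g (y : uKappa' k l n') : uKappa' k l n := ⟨tilde k y, h2 y y.2⟩
  refine ⟨{ toFun := f
            invFun := g
            map_add' := fun x y => Subtype.ext
              (map_add (tilde k) (x : uKappa' k l n).1 (y : uKappa' k l n).1)
            map_smul' := fun a y => ?_
            left_inv := fun y => Subtype.ext (tilde_tilde _)
            right_inv := fun y => Subtype.ext (tilde_tilde _) }⟩
  apply Subtype.ext
  change tilde k (tilde k a * (y : uKappa' k l n).1) = a * tilde k (y : uKappa' k l n).1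
  rw [map_mul, tilde_tilde]

end OddRoot
end Specialized

end SmallQuantum

end

theorem proposition5 (k : Type*) [Field k] [CharZero k] [Algebra SmallQuantum.A k]
    (l : ℕ) (hl : 1 < l) (hodd : Odd l) (hq : IsPrimitiveRoot (SmallQuantum.q k) l)
    (n : ℤ) (hn : n ∈ Set.Ico (0 : ℤ) (2 * l)) :
    (∀ m : ℤ, n = 2 * m →
      SmallQuantum.DecomposesAs k l (SmallQuantum.uKappa' k l n)
        {r : ℤ | (r : ℚ) ∈ Set.Ico (0 : ℚ) (m / 2) ∪ Set.Icc (m : ℚ) ((l + m - 1) / 2)}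
        (fun r => 2 * r - m)
        (fun r => (Even m ∧ (r : ℚ) = (l + m - 1) / 2) ∨ (Odd m ∧ (r : ℚ) = (m - 1) / 2))) ∧
    (Odd n →
      SmallQuantum.DecomposesAs k l (SmallQuantum.Twist (SmallQuantum.uKappa' k l n))
        {r : ℤ |
          (n = 1 ∧ (r : ℚ) ∈ Set.Icc (0 : ℚ) ((l - 1) / 4) ∪
            Set.Ico ((l + 1) / 2 : ℚ) ((3 * l + 1) / 4)) ∨
          (1 < n ∧ n < l ∧ (r : ℚ) ∈ Set.Ico (0 : ℚ) ((l + n) / 4) ∪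
            Set.Ico ((l + n) / 2 : ℚ) ((3 * l + n) / 4)) ∨
          (l ≤ n ∧ (r : ℚ) ∈ Set.Ico (0 : ℚ) ((n - l) / 4) ∪
            Set.Ico ((n - l) / 2 : ℚ) ((l + n) / 4))}
        (fun r => 2 * r + (l - 1) * n / 2)
        (fun r => 4 * r ≡ n - 2 [ZMOD l])) := by
  have h : SmallQuantum.OddRoot k l := ⟨hl, hodd, hq⟩
  obtain ⟨c, hc⟩ := hodd
  obtain ⟨hn0, hnl⟩ := hn
  -- Clearing denominators in the bounds.
  have le_iff : ∀ (a b : ℤ) (d : ℕ), 0 < d → ((a : ℚ) ≤ b / d ↔ d * a ≤ b) := by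
    intro a b d hd
    rw [le_div_iff₀ (by exact_mod_cast hd), mul_comm]
    exact_mod_cast Iff.rfl
  have lt_iff : ∀ (a b : ℤ) (d : ℕ), 0 < d → ((a : ℚ) < b / d ↔ d * a < b) := by
    intro a b d hd
    rw [lt_div_iff₀ (by exact_mod_cast hd), mul_comm]
    exact_mod_cast Iff.rfl
  have ge_iff : ∀ (a b : ℤ) (d : ℕ), 0 < d → ((b : ℚ) / d ≤ a ↔ b ≤ d * a) := by
    intro a b d hd
    rw [div_le_iff₀ (by exact_mod_cast hd), mul_comm]
    exact_mod_cast Iff.rfl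
  have eq_iff : ∀ (a b : ℤ), ((a : ℚ) = b / 2 ↔ 2 * a = b) := by
    intro a b
    rw [eq_div_iff two_ne_zero, mul_comm]
    exact_mod_cast Iff.rfl
  refine ⟨fun m hm => ?_, fun hnodd => ?_⟩
  · subst hm
    have hm0 : 0 ≤ m := by omega
    have hml : m < l := by omega
    have hS : ∀ r : ℤ, ((Even m ∧ (r : ℚ) = (l + m - 1) / 2) ∨ (Odd m ∧ (r : ℚ) = (m - 1) / 2)) ↔
        ((Even m ∧ 2 * r = l + m - 1) ∨ (Odd m ∧ 2 * r = m - 1)) := by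
      intro r
      have e1 := eq_iff r (l + m - 1)
      have e2 := eq_iff r (m - 1)
      push_cast at e1 e2
      rw [e1, e2]
    have hI : {r : ℤ | (r : ℚ) ∈ Set.Ico (0 : ℚ) (m / 2) ∪ Set.Icc (m : ℚ) ((l + m - 1) / 2)} =
        SmallQuantum.indexSet l m := by
      ext r
      have e1 := lt_iff r m 2 two_pos
      have e2 := le_iff r (l + m - 1) 2 two_pos
      push_cast at e1 e2
      rw [Finset.mem_coe, SmallQuantum.mem_indexSet hm0 hml]
      simp only [Set.mem_ofPred_eq, Set.mem_union, Set.mem_Ico, Set.mem_Icc, e1, e2, Int.cast_le,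
        Int.cast_nonneg_iff]
      omega
    refine h.decomposesAs_of_linearEquiv hm0 hml (LinearEquiv.refl _ _) hI
      (fun r _ => by rw [sub_self]; exact dvd_zero _) ?_ ?_
    · simp only [hS, hI, Finset.mem_coe, SmallQuantum.mem_indexSet hm0 hml]
      rcases Int.even_or_odd' m with ⟨d, hd | hd⟩
      · exact ⟨c + d, by omega, Or.inl ⟨⟨d, by omega⟩, by omega⟩⟩
      · exact ⟨d, by omega, Or.inr ⟨⟨d, hd⟩, by omega⟩⟩
    · intro r _ hr
      rcases (hS r).mp hr with ⟨_, h1⟩ | ⟨_, h1⟩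
      · exact ⟨1, by omega⟩
      · exact ⟨0, by omega⟩
  · obtain ⟨d, hd⟩ := hnodd
    have hst : ∀ m : ℤ, (l : ℤ) ∣ 2 * m - n → ∀ r : ℤ,
        4 * r ≡ n - 2 [ZMOD l] ↔ (l : ℤ) ∣ 2 * r - m + 1 := by
      intro m hm r
      rw [Int.modEq_comm, Int.modEq_iff_dvd, ← h.dvd_two_mul (n := 2 * r - m + 1),
        show 4 * r - (n - 2) = 2 * (2 * r - m + 1) + (2 * m - n) by ring, dvd_add_left hm]
    have hwt : ∀ m : ℤ, (l : ℤ) ∣ 2 * m - n → ∀ r : ℤ,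
        (l : ℤ) ∣ 2 * r + (l - 1) * n / 2 - (2 * r - m) := by
      intro m hm r
      have e1 : ((l : ℤ) - 1) * n / 2 = c * n := by
        rw [show ((l : ℤ) - 1) * n = 2 * (c * n) by rw [hc]; push_cast; ring,
          Int.mul_ediv_cancel_left _ two_ne_zero]
      rw [← h.dvd_two_mul, e1, show 2 * (2 * r + c * n - (2 * r - m)) =
        l * n + (2 * m - n) by rw [hc]; push_cast; ring]
      exact dvd_add (dvd_mul_right _ _) hm
    -- The Steinberg index for the even number `2m`.
    have hex : ∀ m : ℤ, 0 ≤ m → m < l → ∃ r ∈ SmallQuantum.indexSet l m,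
        (l : ℤ) ∣ 2 * r - m + 1 := by
      intro m hm0 hml
      simp only [SmallQuantum.mem_indexSet hm0 hml]
      rcases Int.even_or_odd' m with ⟨d, hd | hd⟩
      · exact ⟨c + d, by omega, ⟨1, by omega⟩⟩
      · exact ⟨d, by omega, ⟨0, by omega⟩⟩
    obtain ⟨m, t, ht, hm, hm0, hml, hI⟩ : ∃ m t : ℤ, Odd t ∧ 2 * m = n + t * l ∧ 0 ≤ m ∧ m < l ∧
        {r : ℤ |
          (n = 1 ∧ (r : ℚ) ∈ Set.Icc (0 : ℚ) ((l - 1) / 4) ∪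
            Set.Ico ((l + 1) / 2 : ℚ) ((3 * l + 1) / 4)) ∨
          (1 < n ∧ n < l ∧ (r : ℚ) ∈ Set.Ico (0 : ℚ) ((l + n) / 4) ∪
            Set.Ico ((l + n) / 2 : ℚ) ((3 * l + n) / 4)) ∨
          (l ≤ n ∧ (r : ℚ) ∈ Set.Ico (0 : ℚ) ((n - l) / 4) ∪
            Set.Ico ((n - l) / 2 : ℚ) ((l + n) / 4))} = SmallQuantum.indexSet l m := by
      have hset : ∀ r : ℤ, (
          (n = 1 ∧ (r : ℚ) ∈ Set.Icc (0 : ℚ) ((l - 1) / 4) ∪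
            Set.Ico ((l + 1) / 2 : ℚ) ((3 * l + 1) / 4)) ∨
          (1 < n ∧ n < l ∧ (r : ℚ) ∈ Set.Ico (0 : ℚ) ((l + n) / 4) ∪
            Set.Ico ((l + n) / 2 : ℚ) ((3 * l + n) / 4)) ∨
          (l ≤ n ∧ (r : ℚ) ∈ Set.Ico (0 : ℚ) ((n - l) / 4) ∪
            Set.Ico ((n - l) / 2 : ℚ) ((l + n) / 4))) ↔
          (n = 1 ∧ ((0 ≤ r ∧ 4 * r ≤ l - 1) ∨ (l + 1 ≤ 2 * r ∧ 4 * r < 3 * l + 1))) ∨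
          (1 < n ∧ n < l ∧ ((0 ≤ r ∧ 4 * r < l + n) ∨ (l + n ≤ 2 * r ∧ 4 * r < 3 * l + n))) ∨
          (l ≤ n ∧ ((0 ≤ r ∧ 4 * r < n - l) ∨ (n - l ≤ 2 * r ∧ 4 * r < l + n))) := by
        intro r
        have e1 := le_iff r (l - 1) 4 four_pos
        have e2 := ge_iff r (l + 1) 2 two_pos
        have e3 := lt_iff r (3 * l + 1) 4 four_pos
        have e4 := lt_iff r (l + n) 4 four_pos
        have e5 := ge_iff r (l + n) 2 two_pos
        have e6 := lt_iff r (3 * l + n) 4 four_pos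
        have e7 := lt_iff r (n - l) 4 four_pos
        have e8 := ge_iff r (n - l) 2 two_pos
        push_cast at e1 e2 e3 e4 e5 e6 e7 e8
        simp only [Set.mem_union, Set.mem_Ico, Set.mem_Icc, e1, e2, e3, e4, e5, e6, e7, e8,
          Int.cast_nonneg_iff]
      by_cases hnl' : n < l
      · refine ⟨c + d + 1, 1, odd_one, by omega, by omega, by omega, ?_⟩
        ext r
        rw [Set.mem_ofPred_eq, hset, Finset.mem_coe,
          SmallQuantum.mem_indexSet (by omega) (by omega)]
        omega
      · refine ⟨d - c, -1, odd_neg_one, by omega, by omega, by omega, ?_⟩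
        ext r
        rw [Set.mem_ofPred_eq, hset, Finset.mem_coe,
          SmallQuantum.mem_indexSet (by omega) (by omega)]
        omega
    have hdvd : (l : ℤ) ∣ 2 * m - n := ⟨t, by rw [hm]; ring⟩
    obtain ⟨e⟩ := h.exists_twist_equiv ht hm
    refine h.decomposesAs_of_linearEquiv hm0 hml e hI (fun r _ => hwt m hdvd r) ?_
      fun r _ hr => (hst m hdvd r).mp hr
    obtain ⟨r, hr, hr'⟩ := hex m hm0 hml
    exact ⟨r, by rw [hI]; exact hr, (hst m hdvd r).mpr hr'⟩
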